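/- **Setting.** Let $\Omega\subset\mathbb R^3$ be a bounded open set with Lipschitz boundary $\Sigma$, and let $\Omega_1$ be an open set with $\bar\Omega_1\subset\Omega$ whose boundary $\Gamma=\partial\Omega_1$ is a $C^2$ surface. Put $\Omega_2=\Omega\setminus\bar\Omega_1$. An *element* $K$ is an open right hexahedron with edges parallel to the coordinate axes, and $h_K$ is its diameter. Let $\mathcal T$ be a finite mesh of pairwise disjoint elements whose closures cover $\Omega$; hanging nodes are allowed. It is shape regular: all sides of $K\in\mathcal T$ have length at least $\kappa h_K$, with a fixed $\kappa>0$. For a set $\mathcal S$ of elements let $\mathcal S^\Gamma=\{K\in\mathcal S:K\cap\Gamma\ne\emptyset\}$ and $\mathcal S^\Sigma=\{K\in\mathcal S:K\cap\Sigma\neq\emptyset\}$. Assume that $\Gamma$ intersects every $K\in\mathcal T^\Gamma$ properly and $\Sigma$ intersects every $K\in\mathcal T^\Sigma$ properly. Here a surface intersects $K$ properly if it meets each edge of $K$ at most once, meets the edges of each face at most twice and only at points of the open edges, and if, whenever both end points of an edge of $K$ are in $\Omega_i$, the edge is contained in $\Omega_i$. Let $\delta_0\in(0,1/2)$. An element $K$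 is *large with respect to* $\Omega_i$ if $K\subset\Omega_i$, or if $K$ meets $\Gamma\cup\Sigma$ and $|e\cap\Omega_i|\ge\delta_0|e|$ for each edge $e$ of $K$ that meets $\Omega_i$. An element $K\in\mathcal T^\Gamma\cup\mathcal T^\Sigma$ is *large* if it is large with respect to both $\Omega_1,\Omega_2$ when $K\in\mathcal T^\Gamma$, and large with respect to $\Omega_2$ when $K\in\mathcal T^\Sigma$. **(H1)** Each $K\in\mathcal T^\Gamma\cup\mathcal T^\Sigma$ has a macro-element $N(K)$, a right hexahedron that is the union of $K$ and other elements of $\mathcal T$ (up to their boundaries). It is large with respect to both $\Omega_1,\Omega_2$ if $K\in\mathcal T^\Gamma$, and with respect to $\Omega_2$ if $K\in\mathcal T^\Sigma$. Moreover $h_{N(K)}\le C_0h_K$ with a fixed constant $C_0$, and $N(K)=K$ if $K$ is large. The induced mesh $\mathcal M$ consists of the macro-elements $N(K)$, $K\in\mathcal T^\Gamma\cup\mathcal T^\Sigma$, and of the elements of $\mathcal T$ that are contained in $\Omega_1$ or in $\Omega_2$ but in no macro-element. Assume that no element of $\mathcal M$ meets both $\Gamma$ and $\Sigma$. **Deviations.**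 For $A,B\subset\mathbb R^3$ let $\mathrm{dist}_{\rm H}(A,B)=\sup_{x\in A}\inf_{y\in B}|x-y|$. * Let $K\in\mathcal M^\Gamma$, let $\Gamma_K=K\cap\Gamma$, and let $\mathcal V_K$ be the set of points where $\Gamma$ meets the edges of $K$. Fix a decomposition $\bar K=\bar K_1^h\cup\bar K_2^h$ into two polyhedra with disjoint interiors, where $\bar K_i^h$ is a union of closed nondegenerate tetrahedra whose vertices are vertices of $K$ in $\Omega_i$ or points of $\mathcal V_K$, and which have a common vertex $A_K^i$ that is a vertex of $K$ in $\Omega_i$; let $\partial K_1^h\cap\partial K_2^h=\bigcup_jf_j$ with nondegenerate triangles $f_j$ with vertices in $\mathcal V_K$. Let $\Gamma_K^h$ be one of the planes $F_j\supset f_j$ for which $\mathrm{dist}_{\rm H}(\Gamma_K,F_j)$ is smallest. Then $$\eta_K=\max_{i=1,2}\frac{\mathrm{dist}_{\rm H}(\Gamma_K,\Gamma_K^h)}{\mathrm{dist}(A_K^i,\Gamma_K^h)}.$$ * Let $K\in\mathcal M^\Sigma$, let $\Sigma_K=K\cap\Sigma$, and let $\mathcal V_K'$ be the set of points where $\Sigma$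 meets the edges of $K$. Fix a polyhedron $K^h\subset K$ such that $\bar K^h$ is a union of closed nondegenerate tetrahedra whose vertices are vertices of $K$ in $\Omega$ or points of $\mathcal V_K'$, and which have a common vertex $A_K'$ that is a vertex of $K$ in $\Omega$; let $\overline{\partial K^h\setminus\partial K}=\bigcup_jf_j'$ with nondegenerate triangles $f'_j$ with vertices in $\mathcal V_K'$. Let $\Sigma_K^h$ be one of the planes $F_j'\supset f_j'$ for which $\mathrm{dist}_{\rm H}(\Sigma_K,F'_j)$ is smallest. Then $$\eta_K=\frac{\mathrm{dist}_{\rm H}(\Sigma_K,\Sigma_K^h)}{\mathrm{dist}(A_K',\Sigma_K^h)}.$$ **(H2)** $\eta_K\le 1/2$. **Statement.** Let $\mathsf T(t)=t+\sqrt{t^2-1}$ for $t\ge1$, and let $Q_p$ be the set of polynomials in three variables, with real or complex coefficients, of degree at most $p$ in each variable. There is a constant $C>0$ depending only on $\Omega,\Omega_1,\kappa,\delta_0,C_0$ (in particular not on $h_K$, $p$, $\eta_K$ or the mesh) such that, if (H1) holds, then for every $K\in\mathcal M^\Gamma\cup\mathcal M^\Sigma$ and every choice of the above construction for $K$ for which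 (H2) holds, the sets $K_i=K\cap\Omega_i$ satisfy, for $i=1,2$, all integers $p\ge1$ and all $v\in Q_p$, $$\|v\|_{L^2(\partial K_i)}\le C\,p\,h_K^{-1/2}\,\mathsf T\!\left(\frac{1+3\eta_K}{1-\eta_K}\right)^{3p}\|v\|_{L^2(K_i)} .$$ -/

import Mathlib

open Set MeasureTheory
open scoped ENNReal NNReal

noncomputable section

namespace UnfittedFEM

/-- Three dimensional Euclidean space. -/
abbrev E3 : Type := EuclideanSpace ℝ (Fin 3)

/-! ### The domain, the interface and the boundary -/

/-- The boundary of `U` is, near each of its points and after a rigid motion of the coordinate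
axes, the graph of a function `ψ : ℝ² → ℝ` with the regularity `reg`, and `U` is the part below
the graph. -/
def HasGraphBoundary (reg : (EuclideanSpace ℝ (Fin 2) → ℝ) → Prop) (U : Set E3) : Prop :=
  ∀ x ∈ frontier U, ∃ r : ℝ, 0 < r ∧ ∃ (L : E3 ≃ₗᵢ[ℝ] E3) (ψ : EuclideanSpace ℝ (Fin 2) → ℝ),
    reg ψ ∧ ∀ y ∈ Metric.ball x r,
      (y ∈ U ↔ (L y) 2 < ψ !₂[(L y) 0, (L y) 1]) ∧
      (y ∈ frontier U ↔ (L y) 2 = ψ !₂[(L y) 0, (L y) 1])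

/-- `Ω` is bounded and open with Lipschitz boundary, `Ω₁` is open with closure in `Ω`,
and the interface `∂Ω₁` is a `C²` surface. -/
structure IsInterfaceGeometry (Ω Ω₁ : Set E3) : Prop where
  isOpen : IsOpen Ω
  isBounded : Bornology.IsBounded Ω
  isOpen_one : IsOpen Ω₁
  closure_subset : closure Ω₁ ⊆ Ω
  lipschitz_boundary : HasGraphBoundary (fun ψ => ∃ L : ℝ≥0, LipschitzWith L ψ) Ω
  smooth_interface : HasGraphBoundary (fun ψ => ContDiff ℝ 2 ψ) Ω₁

/-- The two subdomains: index `0` is `Ω₁`, index `1` is `Ω₂ = Ω \ closure Ω₁`. With the interface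
`Γ = frontier Ω₁` one has `Ω = Ω₁ ∪ Γ ∪ Ω₂`. The boundary is `Σ = frontier Ω`. -/
def subdomain (Ω Ω₁ : Set E3) : Fin 2 → Set E3 := ![Ω₁, Ω \ closure Ω₁]

/-! ### Right hexahedra -/

/-- A right hexahedron with edges parallel to the coordinate axes. -/
structure Hexahedron where
  lo : E3
  hi : E3
  lo_lt_hi : ∀ k, lo k < hi k

namespace Hexahedron

/-- The hexahedron as an open set. -/
def carrier (K : Hexahedron) : Set E3 := {x | ∀ k, K.lo k < x k ∧ x k < K.hi k}

/-- The closed hexahedron. -/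
def closed (K : Hexahedron) : Set E3 := {x | ∀ k, K.lo k ≤ x k ∧ x k ≤ K.hi k}

/-- The diameter `h_K`. -/
def size (K : Hexahedron) : ℝ := Metric.diam K.carrier

/-- The eight vertices. -/
def vertices (K : Hexahedron) : Set E3 := {x | ∀ k, x k = K.lo k ∨ x k = K.hi k}

/-- `segment ℝ a b` is one of the twelve edges. -/
def IsEdge (K : Hexahedron) (a b : E3) : Prop :=
  a ∈ K.vertices ∧ b ∈ K.vertices ∧ ∃ k, a k ≠ b k ∧ ∀ l, l ≠ k → a l = b l

/-- The (closed) edges lying in the face on which the coordinate `k` has the value `c`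
(`c = lo k` or `c = hi k`). -/
def IsFaceEdge (K : Hexahedron) (k : Fin 3) (c : ℝ) (a b : E3) : Prop :=
  K.IsEdge a b ∧ a k = c ∧ b k = c

/-- The intersection points of a surface `S` and the edges of `K`. -/
def edgePoints (K : Hexahedron) (S : Set E3) : Set E3 :=
  {x | x ∈ S ∧ ∃ a b, K.IsEdge a b ∧ x ∈ segment ℝ a b}

/-- The surface `S` (the interface or the boundary) intersects `K` properly: it meets each edge at
most once, it meets the edges of each face at most twice and at (relatively) open sides, and an
edge whose two end points are in the same subdomain is contained in this subdomain. -/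
def ProperlyIntersects (Ω Ω₁ S : Set E3) (K : Hexahedron) : Prop :=
  (∀ a b, K.IsEdge a b → (segment ℝ a b ∩ S).Subsingleton) ∧
  (∀ k c, {x | x ∈ S ∧ ∃ a b, K.IsFaceEdge k c a b ∧ x ∈ segment ℝ a b}.encard ≤ 2) ∧
  (∀ a b, K.IsEdge a b → segment ℝ a b ∩ S ⊆ openSegment ℝ a b) ∧
  (∀ i a b, K.IsEdge a b → a ∈ subdomain Ω Ω₁ i → b ∈ subdomain Ω Ω₁ i →
    segment ℝ a b ⊆ subdomain Ω Ω₁ i)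

/-- The hexahedron meets the interface. -/
def MeetsInterface (Ω₁ : Set E3) (K : Hexahedron) : Prop := (K.carrier ∩ frontier Ω₁).Nonempty

/-- The hexahedron meets the boundary. -/
def MeetsBoundary (Ω : Set E3) (K : Hexahedron) : Prop := (K.carrier ∩ frontier Ω).Nonempty

/-- `K` is large with respect to the subdomain of index `i`, with the constant `δ₀`: either `K` is
contained in it, or `K` meets the interface or the boundary and each edge of `K` that meets the
subdomain has at least the fraction `δ₀` of its length in it. -/
def LargeWrt (Ω Ω₁ : Set E3) (δ₀ : ℝ) (i : Fin 2) (K : Hexahedron) : Prop :=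
  K.carrier ⊆ subdomain Ω Ω₁ i ∨
  ((K.MeetsInterface Ω₁ ∨ K.MeetsBoundary Ω) ∧
    ∀ a b, K.IsEdge a b → (segment ℝ a b ∩ subdomain Ω Ω₁ i).Nonempty →
      ENNReal.ofReal δ₀ ≤
        volume {t : ℝ | t ∈ Icc (0 : ℝ) 1 ∧ AffineMap.lineMap a b t ∈ subdomain Ω Ω₁ i})

/-- The condition of being large that is appropriate for `K`: with respect to both subdomains if
`K` meets the interface, with respect to `Ω₂` if `K` meets the boundary. -/
def Large (Ω Ω₁ : Set E3) (δ₀ : ℝ) (K : Hexahedron) : Prop :=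
  (K.MeetsInterface Ω₁ → ∀ i, K.LargeWrt Ω Ω₁ δ₀ i) ∧
  (K.MeetsBoundary Ω → K.LargeWrt Ω Ω₁ δ₀ 1)

end Hexahedron

/-! ### Meshes -/

/-- A mesh of right hexahedra covering `Ω`, shape regular with constant `κ`. No conformity is
required, so hanging nodes are allowed. -/
structure IsMesh (Ω : Set E3) (κ : ℝ) (T : Set Hexahedron) : Prop where
  finite : T.Finite
  disjoint : ∀ K ∈ T, ∀ K' ∈ T, K ≠ K' → Disjoint K.carrier K'.carrier
  covers : Ω ⊆ ⋃ K ∈ T, K.closed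
  shape_regular : ∀ K ∈ T, ∀ k, κ * K.size ≤ K.hi k - K.lo k

/-- The elements of a mesh that meet the interface. -/
def interfaceElements (Ω₁ : Set E3) (T : Set Hexahedron) : Set Hexahedron :=
  {K | K ∈ T ∧ K.MeetsInterface Ω₁}

/-- The elements of a mesh that meet the boundary. -/
def boundaryElements (Ω : Set E3) (T : Set Hexahedron) : Set Hexahedron :=
  {K | K ∈ T ∧ K.MeetsBoundary Ω}

/-- The interface and the boundary intersect the elements of the mesh properly. -/
def IsProperMesh (Ω Ω₁ : Set E3) (T : Set Hexahedron) : Prop :=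
  (∀ K ∈ interfaceElements Ω₁ T, K.ProperlyIntersects Ω Ω₁ (frontier Ω₁)) ∧
  (∀ K ∈ boundaryElements Ω T, K.ProperlyIntersects Ω Ω₁ (frontier Ω))

/-- The assumption on macro-elements: each interface or boundary element `K` of the mesh has a macro-element `N K`,
a right hexahedron that is the union of `K` and other elements of the mesh, which is large with
respect to both subdomains (if `K` is an interface element) or with respect to `Ω₂` (if `K` is a
boundary element), and whose diameter is at most `C₀` times that of `K`. Moreover `N K = K` if `K`
is already large. -/
structure IsMacroElementMap (Ω Ω₁ : Set E3) (δ₀ C₀ : ℝ) (T : Set Hexahedron)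
    (N : Hexahedron → Hexahedron) : Prop where
  union : ∀ K ∈ interfaceElements Ω₁ T ∪ boundaryElements Ω T,
    ∃ S ⊆ T, K ∈ S ∧ (N K).closed = ⋃ K' ∈ S, K'.closed
  large_interface : ∀ K ∈ interfaceElements Ω₁ T, ∀ i, (N K).LargeWrt Ω Ω₁ δ₀ i
  large_boundary : ∀ K ∈ boundaryElements Ω T, (N K).LargeWrt Ω Ω₁ δ₀ 1
  size_le : ∀ K ∈ interfaceElements Ω₁ T ∪ boundaryElements Ω T, (N K).size ≤ C₀ * K.size
  eq_self : ∀ K ∈ interfaceElements Ω₁ T ∪ boundaryElements Ω T, K.Large Ω Ω₁ δ₀ → N K = K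

/-- The induced mesh: the macro-elements, and the elements inside one of the subdomains that are
not contained in a macro-element. -/
def inducedMesh (Ω Ω₁ : Set E3) (T : Set Hexahedron) (N : Hexahedron → Hexahedron) :
    Set Hexahedron :=
  N '' (interfaceElements Ω₁ T ∪ boundaryElements Ω T) ∪
  {K | K ∈ T ∧ (∃ i, K.carrier ⊆ subdomain Ω Ω₁ i) ∧
    ∀ K' ∈ interfaceElements Ω₁ T ∪ boundaryElements Ω T, ¬ K.carrier ⊆ (N K').carrier}

/-! ### Interface deviation and boundary deviation -/

/-- `dist_H(A, B) = sup_{x ∈ A} inf_{y ∈ B} |x - y|`. -/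
def distH (A B : Set E3) : ℝ≥0∞ := ⨆ x ∈ A, Metric.infEDist x B

/-- The plane through the vertices of a triangle. -/
def planeOf (f : Affine.Triangle ℝ E3) : Set E3 := (affineSpan ℝ (range f.points) : Set E3)

/-- The closed polyhedron that is the union of the given (closed) tetrahedra. -/
def polyhedron {m : ℕ} (tet : Fin m → Affine.Simplex ℝ E3 3) : Set E3 :=
  ⋃ j, (tet j).closedInterior

/-- A decomposition of an interface element `K` into two polyhedra `K₁ʰ`, `K₂ʰ`, each a union of
tetrahedra with a common vertex `A_Kⁱ`, together with the plane `Γ_Kʰ` selected from it. -/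
structure InterfaceSplitting (Ω Ω₁ : Set E3) (K : Hexahedron) where
  /-- the number of tetrahedra on each side -/
  m : Fin 2 → ℕ
  /-- the tetrahedra -/
  tet : ∀ i, Fin (m i) → Affine.Simplex ℝ E3 3
  /-- the common vertex of the tetrahedra on each side, a vertex of `K` in the subdomain -/
  apex : Fin 2 → E3
  apex_mem : ∀ i, apex i ∈ K.vertices ∩ subdomain Ω Ω₁ i
  apex_vertex : ∀ i j, ∃ k, (tet i j).points k = apex i
  /-- the vertices of the tetrahedra are vertices of `K` in the subdomain or intersection points
  of the interface and the edges of `K` -/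
  vertex_mem : ∀ i j k, (tet i j).points k ∈
    (K.vertices ∩ subdomain Ω Ω₁ i) ∪ K.edgePoints (frontier Ω₁)
  cover : (⋃ i, polyhedron (tet i)) = K.closed
  disjoint : Disjoint (interior (polyhedron (tet 0))) (interior (polyhedron (tet 1)))
  /-- the number of triangles that make up the common boundary of the two polyhedra -/
  J : ℕ
  /-- the triangles, with vertices on the interface -/
  face : Fin J → Affine.Triangle ℝ E3
  face_vertex_mem : ∀ j k, (face j).points k ∈ K.edgePoints (frontier Ω₁)
  face_union : frontier (polyhedron (tet 0)) ∩ frontier (polyhedron (tet 1)) =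
    ⋃ j, (face j).closedInterior
  /-- the plane of the triangle `best` is the one closest to `Γ_K = K ∩ Γ` -/
  best : Fin J
  best_le : ∀ j, distH (K.carrier ∩ frontier Ω₁) (planeOf (face best)) ≤
    distH (K.carrier ∩ frontier Ω₁) (planeOf (face j))

/-- The interface deviation `η_K`, as an extended nonnegative number (`a / 0 = ∞` for `a ≠ 0`). -/
def InterfaceSplitting.deviation {Ω Ω₁ : Set E3} {K : Hexahedron}
    (D : InterfaceSplitting Ω Ω₁ K) : ℝ≥0∞ :=
  ⨆ i, distH (K.carrier ∩ frontier Ω₁) (planeOf (D.face D.best)) /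
    Metric.infEDist (D.apex i) (planeOf (D.face D.best))

/-- A polyhedron `Kʰ ⊆ K` for a boundary element `K`, a union of tetrahedra with a common vertex
`A'_K`, together with the plane `Σ_Kʰ` selected from it. -/
structure BoundarySplitting (Ω : Set E3) (K : Hexahedron) where
  /-- the number of tetrahedra -/
  m : ℕ
  /-- the tetrahedra -/
  tet : Fin m → Affine.Simplex ℝ E3 3
  /-- the common vertex of the tetrahedra, a vertex of `K` in `Ω` -/
  apex : E3
  apex_mem : apex ∈ K.vertices ∩ Ω
  apex_vertex : ∀ j, ∃ k, (tet j).points k = apex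
  /-- the vertices of the tetrahedra are vertices of `K` in `Ω` or intersection points of the
  boundary and the edges of `K` -/
  vertex_mem : ∀ j k, (tet j).points k ∈ (K.vertices ∩ Ω) ∪ K.edgePoints (frontier Ω)
  /-- the number of triangles that make up the part of the boundary of the polyhedron inside `K` -/
  J : ℕ
  /-- the triangles, with vertices on the boundary of `Ω` -/
  face : Fin J → Affine.Triangle ℝ E3
  face_vertex_mem : ∀ j k, (face j).points k ∈ K.edgePoints (frontier Ω)
  /-- the closure is taken because the triangles are closed -/
  face_union : closure (frontier (polyhedron tet) \ frontier K.carrier) =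
    ⋃ j, (face j).closedInterior
  /-- the plane of the triangle `best` is the one closest to `Σ_K = K ∩ Σ` -/
  best : Fin J
  best_le : ∀ j, distH (K.carrier ∩ frontier Ω) (planeOf (face best)) ≤
    distH (K.carrier ∩ frontier Ω) (planeOf (face j))

/-- The boundary deviation `η_K`, as an extended nonnegative number (`a / 0 = ∞` for `a ≠ 0`). -/
def BoundarySplitting.deviation {Ω : Set E3} {K : Hexahedron}
    (D : BoundarySplitting Ω K) : ℝ≥0∞ :=
  distH (K.carrier ∩ frontier Ω) (planeOf (D.face D.best)) /
    Metric.infEDist D.apex (planeOf (D.face D.best))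

/-! ### Polynomials and norms -/

/-- `T(t) = t + √(t² - 1)`, used for `t ≥ 1`. -/
def growth (t : ℝ) : ℝ := t + √(t ^ 2 - 1)

/-- The function on `ℝ³` given by a polynomial with real or complex coefficients. -/
def polyFun {𝕜 : Type*} [RCLike 𝕜] (v : MvPolynomial (Fin 3) 𝕜) (x : E3) : 𝕜 :=
  MvPolynomial.eval (fun k => ((x k : ℝ) : 𝕜)) v

/-- `v ∈ Q_p`: the degree of `v` in each variable is at most `p`. -/
def IsQ {𝕜 : Type*} [RCLike 𝕜] (p : ℕ) (v : MvPolynomial (Fin 3) 𝕜) : Prop :=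
  ∀ k, v.degreeOf k ≤ p

/-- The norm of `L²(D)` for a region `D ⊆ ℝ³`. -/
def normL2 {𝕜 : Type*} [RCLike 𝕜] (D : Set E3) (f : E3 → 𝕜) : ℝ≥0∞ :=
  eLpNorm f 2 (volume.restrict D)

/-- The norm of `L²(∂D)` with respect to the surface measure, that is, the two dimensional
Hausdorff measure normalized so that it agrees with area on planes. -/
def boundaryNormL2 {𝕜 : Type*} [RCLike 𝕜] (D : Set E3) (f : E3 → 𝕜) : ℝ≥0∞ :=
  eLpNorm f 2 ((Measure.euclideanHausdorffMeasure 2).restrict (frontier D))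

/-- The inverse trace estimate with constant `C` for all polynomials on the pieces
`K ∩ Ω₁`, `K ∩ Ω₂` of the element `K` with deviation `η`. -/
def InverseTraceEstimate (𝕜 : Type*) [RCLike 𝕜] (Ω Ω₁ : Set E3) (C : ℝ) (K : Hexahedron)
    (η : ℝ) : Prop :=
  ∀ (i : Fin 2) (p : ℕ), 1 ≤ p → ∀ v : MvPolynomial (Fin 3) 𝕜, IsQ p v →
    boundaryNormL2 (K.carrier ∩ subdomain Ω Ω₁ i) (polyFun v) ≤
      ENNReal.ofReal (C * p * K.size ^ (-(1 / 2) : ℝ) *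
        growth ((1 + 3 * η) / (1 - η)) ^ (3 * p)) *
      normL2 (K.carrier ∩ subdomain Ω Ω₁ i) (polyFun v)

end UnfittedFEM

end

/-! The square `W = |v|²` of the modulus of a polynomial `v ∈ Q_p` is nonnegative, and its restriction
to each line is a real polynomial of degree at most `6p`. The proof only uses these properties of `W`
and the extremal property of the Chebyshev polynomials outside of `[-1, 1]`, for values (growth)
and for first derivatives (an inequality of Markov type).

*Growth.* Let `ℓ` be the signed distance to the selected plane, positive at the vertex `A`, and put
`D = ℓ(A)`, so that the surface is in `{|ℓ| ≤ ηD}`. The part of `K` with `ℓ > ηD` is connected, does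
not meet the surface, and has `A` in its closure, hence it is contained in the subdomain `U` of `A`.
The homothety with center `A` and ratio `s = (1-η)/(1+η)` maps `E = K ∩ {ℓ > -ηD}` into this part.
For a star shaped `E` the integral of `W` over `A + σ(E - A)` is a monotone polynomial in `σ` of degree
at most `6p + 3`, so its value at `σ = 1` is at most `T(2/s - 1)^(6p+3)` times its value at `σ = s`
(`lintegral_le_growth_mul`), and `2/s - 1 = (1+3η)/(1-η)`. The part of `K` with `ℓ < -ηD` is either
inside `U`, in which case `E` is replaced by `K`, or outside (`exists_convex_superset`). In both cases
`K ∩ U ⊆ E`, and since `K` is large at the edges of `A`, the volume of `E` is comparable to `h_K³`.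

*Trace.* `∂(K ∩ U)` is contained in `closure E`, and its area in a ball of radius `r` is at most
`c r²`, with `c` independent of `K`: it is contained in the union of coordinate planes with the
interface and the boundary, which are compact unions of Lipschitz graphs
(`exists_upperRegular_bound`). For a polynomial `w ≥ 0` of degree `n` and `ε ∼ n⁻²` one has
`w(0) ≤ C ∫_ε^1 w(t) dt/t` (`eval_zero_le_integral_div`). Applied to the segments from `x ∈ ∂(K ∩ U)`
to `y ∈ E` and averaged over `y`, this gives a bound of the surface integral of `W` by
`C n² / h_K` times the integral over `E`, using nothing but the area bound
(`volume_mul_lintegral_closure_le`).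

*Degenerate planes.* If the distance of the surface to the plane is `0`, then the deviation does not
exclude that `A` is on the plane. In this case the surface is the whole section of `K` by the plane,
so that `A` would be a point of the surface (`ne_of_frontier_subset_plane`). -/

noncomputable section

namespace UnfittedFEM

open Polynomial

/-! ### Polynomials of one variable -/

lemma growth_eq_exp_arcosh {x : ℝ} (hx : 1 ≤ x) : growth x = Real.exp (Real.arcosh x) := by
  rw [Real.exp_arcosh hx, growth]

lemma one_le_growth {x : ℝ} (hx : 1 ≤ x) : 1 ≤ growth x := by
  have := Real.sqrt_nonneg (x ^ 2 - 1)
  unfold growth; linarith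

lemma growth_le_growth {x y : ℝ} (hx : 1 ≤ x) (hxy : x ≤ y) : growth x ≤ growth y := by
  unfold growth
  gcongr

lemma eval_T_le_growth_pow (n : ℕ) {x : ℝ} (hx : 1 ≤ x) :
    (Chebyshev.T ℝ n).eval x ≤ growth x ^ n := by
  have h0 := Real.arcosh_nonneg hx
  rw [growth_eq_exp_arcosh hx, ← Real.exp_nat_mul]
  conv_lhs => rw [← Real.cosh_arcosh hx]
  rw [Chebyshev.T_real_cosh, Int.cast_natCast, Real.cosh_eq]
  have : Real.exp (-(n * Real.arcosh x)) ≤ Real.exp (n * Real.arcosh x) :=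
    Real.exp_le_exp.2 (by have : 0 ≤ n * Real.arcosh x := by positivity
                          linarith)
  linarith

lemma sinh_nat_mul_le (n : ℕ) {θ : ℝ} (hθ : 0 ≤ θ) :
    Real.sinh (n * θ) ≤ n * Real.exp (n * θ) * Real.sinh θ := by
  have hs : 0 ≤ Real.sinh θ := Real.sinh_nonneg_iff.2 hθ
  induction n with
  | zero => simp
  | succ n ih =>
    have hc : Real.cosh θ ≤ Real.exp θ := by
      rw [← Real.cosh_add_sinh]; linarith
    have hn : 0 ≤ (n : ℝ) * θ := by positivity
    have hc' : Real.cosh (n * θ) ≤ Real.exp (n * θ) := by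
      rw [← Real.cosh_add_sinh]; linarith [Real.sinh_nonneg_iff.2 hn]
    have h1 : Real.exp (n * θ) ≤ Real.exp (n * θ) * Real.exp θ :=
      le_mul_of_one_le_right (Real.exp_pos _).le (Real.one_le_exp hθ)
    push_cast
    rw [add_mul, one_mul, Real.sinh_add, Real.exp_add]
    calc Real.sinh (n * θ) * Real.cosh θ + Real.cosh (n * θ) * Real.sinh θ
        ≤ (n * Real.exp (n * θ) * Real.sinh θ) * Real.exp θ
          + (Real.exp (n * θ) * Real.exp θ) * Real.sinh θ := by
          gcongr
          exact hc'.trans h1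
      _ = _ := by ring

/-- A bound of Markov type. It follows from `T_n' = n U_{n-1}` and
`U_{n-1}(cosh θ) = sinh (n θ) / sinh θ`. -/
lemma eval_derivative_T_le (n : ℕ) {x : ℝ} (hx : 1 ≤ x) :
    (derivative (Chebyshev.T ℝ n)).eval x ≤ (n : ℝ) ^ 2 * growth x ^ n := by
  rw [Chebyshev.T_derivative_eq_U]
  simp only [Int.cast_natCast, eval_mul, eval_natCast]
  have key : (Chebyshev.U ℝ ((n : ℤ) - 1)).eval x ≤ n * growth x ^ n := by
    rcases hx.eq_or_lt with rfl | hx1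
    · rw [Chebyshev.U_eval_one]
      push_cast
      rw [sub_add_cancel]
      exact le_mul_of_one_le_right (by positivity) (one_le_pow₀ (one_le_growth le_rfl))
    · have hpos : 0 < Real.sinh (Real.arcosh x) := Real.sinh_pos_iff.2 (Real.arcosh_pos hx1)
      refine le_of_mul_le_mul_right ?_ hpos
      have := Chebyshev.U_real_cosh (Real.arcosh x) ((n : ℤ) - 1)
      rw [Real.cosh_arcosh hx] at this
      rw [this, growth_eq_exp_arcosh hx, ← Real.exp_nat_mul]
      push_cast
      rw [sub_add_cancel]
      exact sinh_nat_mul_le n (Real.arcosh_nonneg hx)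
  calc (n : ℝ) * _ ≤ n * (n * growth x ^ n) := by gcongr
    _ = _ := by ring

/-- The extremal property of the Chebyshev polynomials outside of `[-1, 1]`, without normalization:
Mathlib has the case `M = 1`, and the limit from the right covers `M = 0`. -/
lemma eval_iterate_derivative_le_mul {n : ℕ} {P : ℝ[X]} {k : ℕ} {x M : ℝ} (hx : 1 ≤ x)
    (hdeg : P.natDegree ≤ n) (hM : 0 ≤ M) (hP : ∀ y ∈ Icc (-1 : ℝ) 1, |P.eval y| ≤ M) :
    (derivative^[k] P).eval x ≤ (derivative^[k] (Chebyshev.T ℝ n)).eval x * M := by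
  have main : ∀ M' : ℝ, M < M' →
      (derivative^[k] P).eval x ≤ (derivative^[k] (Chebyshev.T ℝ n)).eval x * M' := by
    intro M' hM'
    have hpos : 0 < M' := hM.trans_lt hM'
    have h := Chebyshev.eval_iterate_derivative_le_of_forall_abs_le_one (n := n)
      (P := M'⁻¹ • P) (k := k) hx
      ((degree_smul_le _ _).trans (natDegree_le_iff_degree_le.1 hdeg)) (by
        intro y hy
        rw [eval_smul, smul_eq_mul, abs_mul, abs_of_pos (inv_pos.2 hpos), inv_mul_le_one₀ hpos]
        exact (hP y hy).trans hM'.le)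
    rw [iterate_derivative_smul, eval_smul, smul_eq_mul, inv_mul_le_iff₀ hpos] at h
    linarith
  have hlim : Filter.Tendsto (fun M' => (derivative^[k] (Chebyshev.T ℝ n)).eval x * M')
      (nhdsWithin M (Ioi M)) (nhds ((derivative^[k] (Chebyshev.T ℝ n)).eval x * M)) :=
    ((continuous_const.mul continuous_id).tendsto M).mono_left nhdsWithin_le_nhds
  exact ge_of_tendsto hlim (Filter.eventually_of_mem self_mem_nhdsWithin main)

/-- A polynomial of degree at most `n` grows outside of an interval at most like the Chebyshev
polynomial of that interval. -/
lemma eval_one_le_growth_pow_mul {n : ℕ} {P : ℝ[X]} {s M : ℝ} (hs : 0 < s) (hs1 : s ≤ 1)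
    (hdeg : P.natDegree ≤ n) (hP : ∀ y ∈ Icc (0 : ℝ) s, |P.eval y| ≤ M) :
    P.eval 1 ≤ growth (2 / s - 1) ^ n * M := by
  have hM : 0 ≤ M := (abs_nonneg _).trans (hP 0 ⟨le_rfl, hs.le⟩)
  have hx : 1 ≤ 2 / s - 1 := by
    have : 2 ≤ 2 / s := by rw [le_div_iff₀ hs]; linarith
    linarith
  have h := eval_iterate_derivative_le_mul (n := n) (k := 0)
    (P := P.comp (C (s / 2) * X + C (s / 2))) (x := 2 / s - 1) (M := M) hx (by
      refine natDegree_comp_le.trans ?_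
      calc _ ≤ P.natDegree * 1 := by gcongr; exact natDegree_linear_le
        _ ≤ n := by simpa using hdeg) hM (by
      intro y hy
      simp only [eval_comp, eval_add, eval_mul, eval_C, eval_X]
      refine hP _ ⟨?_, ?_⟩ <;> nlinarith [hy.1, hy.2])
  simp only [Function.iterate_zero, id, eval_comp, eval_add, eval_mul, eval_C, eval_X] at h
  rw [show s / 2 * (2 / s - 1) + s / 2 = 1 by field_simp; ring] at h
  exact h.trans (mul_le_mul_of_nonneg_right (eval_T_le_growth_pow n hx) hM)

/-- The polynomial of degree `n` with the value `1` at `0` that becomes the normalized Dirichlet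
kernel `sin ((2n+1)φ) / ((2n+1) sin φ)` on setting `t = sin² φ`. -/
def dirichletPoly (n : ℕ) : ℝ[X] :=
  C (1 / (2 * n + 1 : ℝ)) * (Chebyshev.U ℝ n + Chebyshev.U ℝ ((n : ℤ) - 1)).comp (C (-2) * X + C 1)

lemma natDegree_dirichletPoly_le (n : ℕ) : (dirichletPoly n).natDegree ≤ n := by
  refine (natDegree_C_mul_le _ _).trans (natDegree_comp_le.trans ?_)
  have h1 : (Chebyshev.U ℝ n + Chebyshev.U ℝ ((n : ℤ) - 1)).natDegree ≤ n := by
    refine (natDegree_add_le _ _).trans (max_le ?_ ?_)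
    · rw [Chebyshev.natDegree_U]; omega
    · rw [Chebyshev.natDegree_U]; omega
  calc _ ≤ n * 1 := Nat.mul_le_mul h1 natDegree_linear_le
    _ = n := mul_one n

lemma eval_zero_dirichletPoly (n : ℕ) : (dirichletPoly n).eval 0 = 1 := by
  simp only [dirichletPoly, eval_mul, eval_C, eval_comp, eval_add, eval_X, mul_zero, zero_add,
    Chebyshev.U_eval_one]
  push_cast
  field_simp
  ring

lemma sq_eval_dirichletPoly_mul_le (n : ℕ) {t : ℝ} (h0 : 0 < t) (h1 : t < 1) :
    (dirichletPoly n).eval t ^ 2 * t ≤ 1 / (2 * n + 1 : ℝ) ^ 2 := by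
  obtain ⟨φ, hφ0, hφ1, hφ⟩ : ∃ φ : ℝ, 0 < φ ∧ φ < Real.pi ∧ Real.cos φ = 1 - 2 * t :=
    ⟨Real.arccos (1 - 2 * t), Real.arccos_pos.2 (by linarith),
      lt_of_le_of_ne (Real.arccos_le_pi _) (by
        rw [Ne, Real.arccos_eq_pi]; linarith), Real.cos_arccos (by linarith) (by linarith)⟩
  set ψ := φ / 2 with hψ
  have e : φ = 2 * ψ := by rw [hψ]; ring
  have hs : 0 < Real.sin ψ := Real.sin_pos_of_pos_of_lt_pi (by linarith) (by linarith)
  have hc : 0 < Real.cos ψ := Real.cos_pos_of_mem_Ioo ⟨by linarith, by linarith⟩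
  have ht : t = Real.sin ψ ^ 2 := by
    have := Real.cos_sq' ψ
    rw [e, Real.cos_two_mul] at hφ
    linarith
  have hU := Chebyshev.U_real_cos φ n
  have hV := Chebyshev.U_real_cos φ ((n : ℤ) - 1)
  push_cast at hU hV
  rw [sub_add_cancel] at hV
  set S := (Chebyshev.U ℝ n).eval (Real.cos φ) + (Chebyshev.U ℝ ((n : ℤ) - 1)).eval (Real.cos φ)
    with hS
  have hSs : S * (2 * Real.sin ψ * Real.cos ψ) = 2 * Real.sin ((2 * n + 1) * ψ) * Real.cos ψ := by
    have h2 : S * Real.sin φ = Real.sin ((n + 1) * φ) + Real.sin (n * φ) := by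
      rw [hS, add_mul, hU, hV]
    rw [← Real.sin_two_mul, ← e, h2, Real.sin_add_sin]
    congr 3 <;> rw [e] <;> ring
  have hSs' : S * Real.sin ψ = Real.sin ((2 * n + 1) * ψ) := by
    have : (S * Real.sin ψ - Real.sin ((2 * n + 1) * ψ)) * (2 * Real.cos ψ) = 0 := by linarith
    rcases mul_eq_zero.1 this with h | h
    · linarith
    · linarith
  have hev : (dirichletPoly n).eval t = 1 / (2 * n + 1 : ℝ) * S := by
    simp only [dirichletPoly, eval_mul, eval_C, eval_comp, eval_add, eval_X]
    rw [hS, hφ]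
    ring_nf
  rw [hev, ht]
  calc (1 / (2 * n + 1 : ℝ) * S) ^ 2 * Real.sin ψ ^ 2
      = 1 / (2 * n + 1 : ℝ) ^ 2 * (S * Real.sin ψ) ^ 2 := by
        rw [mul_pow, mul_pow, div_pow, one_pow, mul_assoc]
    _ ≤ 1 / (2 * n + 1 : ℝ) ^ 2 * 1 := by
        gcongr
        rw [hSs']
        exact Real.sin_sq_le_one _
    _ = _ := mul_one _

/-- Within the distance `m⁻²` from `[-1, 1]`, polynomials of degree `m` grow by a bounded factor
only. -/
lemma growth_pow_le_exp {m : ℕ} (hm : 1 ≤ m) {δ : ℝ} (h0 : 0 ≤ δ) (hδ : δ ≤ 1 / (m : ℝ) ^ 2) :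
    growth (1 + δ) ^ m ≤ Real.exp 3 := by
  have hm0 : (1 : ℝ) ≤ m := by exact_mod_cast hm
  have hmi : 1 / (m : ℝ) ≤ 1 := by rw [div_le_one (by linarith)]; exact hm0
  have hmi0 : 0 ≤ 1 / (m : ℝ) := by positivity
  have hd1 : δ ≤ 1 / (m : ℝ) * (1 / m) := by convert hδ using 1; field_simp
  have hd2 : δ ≤ 1 / (m : ℝ) := by nlinarith
  have hsq : √((1 + δ) ^ 2 - 1) ≤ 2 * (1 / m) := by
    refine Real.sqrt_le_iff.2 ⟨by positivity, ?_⟩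
    nlinarith
  have hb : growth (1 + δ) ≤ 3 * (1 / m) + 1 := by unfold growth; linarith
  have h1 : 0 ≤ growth (1 + δ) := zero_le_one.trans (one_le_growth (by linarith))
  calc growth (1 + δ) ^ m ≤ Real.exp (3 * (1 / m)) ^ m := by
        gcongr
        exact hb.trans (Real.add_one_le_exp _)
    _ = Real.exp 3 := by
        rw [← Real.exp_nat_mul]; congr 1; field_simp

/-- A pointwise bound of Nikolskii type at the outside point `0` of the interval `[ε, 1]`. -/
lemma eval_zero_le_integral {m : ℕ} (hm : 1 ≤ m) {f : ℝ[X]} (hdeg : f.natDegree + 1 ≤ m)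
    (hf : ∀ t ∈ Icc (0 : ℝ) 1, 0 ≤ f.eval t) {ε : ℝ} (hε : ε = 1 / (4 * (m : ℝ) ^ 2)) :
    f.eval 0 ≤ 4 * (m : ℝ) ^ 2 * Real.exp 3 * ∫ t in ε..1, f.eval t := by
  have hm0 : (1 : ℝ) ≤ m := by exact_mod_cast hm
  have hm2 : (1 : ℝ) ≤ (m : ℝ) ^ 2 := one_le_pow₀ hm0
  have hε0 : 0 < ε := by rw [hε]; positivity
  have hε1 : ε ≤ 1 / 4 := by
    rw [hε]; apply one_div_le_one_div_of_le <;> linarith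
  have hint : ∀ a b : ℝ, IntervalIntegrable (fun t => f.eval t) volume a b := fun a b =>
    f.continuous.intervalIntegrable a b
  -- an antiderivative of `f`
  obtain ⟨F, hFd, hF⟩ : ∃ F : ℝ[X], F.natDegree ≤ m ∧ derivative F = f := by
    refine ⟨∑ k ∈ Finset.range (f.natDegree + 1), monomial (k + 1) (f.coeff k / (k + 1)), ?_, ?_⟩
    · refine natDegree_sum_le_of_forall_le _ _ fun k hk => (natDegree_monomial_le _).trans ?_
      have := Finset.mem_range.1 hk
      omega
    · rw [derivative_sum]
      conv_rhs => rw [f.as_sum_range]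
      refine Finset.sum_congr rfl fun k _ => ?_
      rw [derivative_monomial]
      push_cast
      rw [div_mul_cancel₀]
      positivity
  have hFint : ∀ a b : ℝ, ∫ t in a..b, f.eval t = F.eval b - F.eval a := by
    intro a b
    refine intervalIntegral.integral_eq_sub_of_hasDerivAt (f := fun t => F.eval t) (fun t _ => ?_) (hint a b)
    have := F.hasDerivAt t
    rwa [hF] at this
  set I := ∫ t in ε..1, f.eval t with hI
  have hI0 : 0 ≤ I := intervalIntegral.integral_nonneg (by linarith) fun t ht =>
    hf t ⟨hε0.le.trans ht.1, ht.2⟩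
  -- the antiderivative on `[ε, 1]`, transported to `[-1, 1]`
  set a : ℝ := (1 - ε) / 2 with ha
  have ha0 : 0 < a := by rw [ha]; linarith
  set R : ℝ[X] := C (F.eval 1) - F.comp (C (-a) * X + C ((1 + ε) / 2)) with hR
  have hRd : R.natDegree ≤ m := by
    refine (natDegree_sub_le _ _).trans (max_le (by simp) (natDegree_comp_le.trans ?_))
    calc _ ≤ m * 1 := Nat.mul_le_mul hFd natDegree_linear_le
      _ = m := mul_one m
  have hRe : ∀ y, R.eval y = F.eval 1 - F.eval (-a * y + (1 + ε) / 2) := by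
    intro y; simp [hR]
  have hRb : ∀ y ∈ Icc (-1 : ℝ) 1, |R.eval y| ≤ I := by
    intro y hy
    have l1 : ε ≤ -a * y + (1 + ε) / 2 := by rw [ha]; nlinarith [hy.1, hy.2]
    have l2 : -a * y + (1 + ε) / 2 ≤ 1 := by rw [ha]; nlinarith [hy.1, hy.2]
    rw [hRe, ← hFint]
    rw [abs_of_nonneg (intervalIntegral.integral_nonneg l2 fun t ht =>
      hf t ⟨by linarith [ht.1], ht.2⟩), hI,
      ← intervalIntegral.integral_add_adjacent_intervals (hint ε (-a * y + (1 + ε) / 2)) (hint _ 1)]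
    have := intervalIntegral.integral_nonneg (μ := volume) (f := fun t => f.eval t) l1 fun t ht =>
      hf t ⟨by linarith [ht.1], by linarith [ht.2]⟩
    linarith
  set δ : ℝ := ε / a with hδ
  have hδ0 : 0 ≤ δ := by positivity
  have hδ1 : δ ≤ 1 / (m : ℝ) ^ 2 := by
    have : δ ≤ 4 * ε := by
      rw [hδ, div_le_iff₀ ha0, ha]; nlinarith
    refine this.trans (le_of_eq ?_)
    rw [hε]; field_simp
  have hx : 1 ≤ 1 + δ := by linarith
  have h := eval_iterate_derivative_le_mul (k := 1) hx hRd hI0 hRb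
  simp only [Function.iterate_one] at h
  have hRder : (derivative R).eval (1 + δ) = a * f.eval 0 := by
    have hpt : -(a * (1 + δ)) + (1 + ε) / 2 = 0 := by
      rw [mul_add, hδ, mul_div_cancel₀ _ ha0.ne', ha]; ring
    simp [hR, derivative_comp, hF, eval_comp, hpt]
  rw [hRder] at h
  have h2 : a * f.eval 0 ≤ (m : ℝ) ^ 2 * Real.exp 3 * I :=
    h.trans (mul_le_mul_of_nonneg_right ((eval_derivative_T_le m hx).trans
      (mul_le_mul_of_nonneg_left (growth_pow_le_exp hm hδ0 hδ1) (by positivity))) hI0)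
  have h3 : (1 / 4 : ℝ) * f.eval 0 ≤ a * f.eval 0 :=
    mul_le_mul_of_nonneg_right (by rw [ha]; linarith) (hf 0 ⟨le_rfl, zero_le_one⟩)
  linarith

/-- The pointwise bound with the scale invariant weight `1 / t`, obtained by localization with the
square of `dirichletPoly`. -/
lemma eval_zero_le_integral_div {n : ℕ} {w : ℝ[X]} (hdeg : w.natDegree ≤ n)
    (hw : ∀ t ∈ Icc (0 : ℝ) 1, 0 ≤ w.eval t) {ε : ℝ}
    (hε : ε = 1 / (4 * ((3 * n + 1 : ℕ) : ℝ) ^ 2)) :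
    w.eval 0 ≤ 16 * Real.exp 3 * ∫ t in ε..1, w.eval t / t := by
  set m := 3 * n + 1 with hm
  have hm0 : (1 : ℝ) ≤ m := by exact_mod_cast (by omega : 1 ≤ m)
  have hm2 : (1 : ℝ) ≤ (m : ℝ) ^ 2 := one_le_pow₀ hm0
  have hε0 : 0 < ε := by rw [hε]; positivity
  have hε1 : ε ≤ 1 / 4 := by
    rw [hε]; apply one_div_le_one_div_of_le <;> linarith
  have hd : (w * dirichletPoly n ^ 2).natDegree + 1 ≤ m := by
    have h1 := natDegree_mul_le (p := w) (q := dirichletPoly n ^ 2)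
    have h2 := natDegree_pow_le (p := dirichletPoly n) (n := 2)
    have h3 := natDegree_dirichletPoly_le n
    omega
  have h := eval_zero_le_integral (m := m) (by omega) hd (fun t ht => by
    rw [eval_mul, eval_pow]; exact mul_nonneg (hw t ht) (sq_nonneg _)) hε
  rw [eval_mul, eval_pow, eval_zero_dirichletPoly, one_pow, mul_one] at h
  have hmono : ∫ t in ε..1, (w * dirichletPoly n ^ 2).eval t ≤
      ∫ t in ε..1, 1 / (2 * n + 1 : ℝ) ^ 2 * (w.eval t / t) := by
    refine intervalIntegral.integral_mono_on_of_le_Ioo (by linarith)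
      ((w * dirichletPoly n ^ 2).continuous.intervalIntegrable _ _) ?_ ?_
    · refine (ContinuousOn.intervalIntegrable ?_)
      refine continuousOn_const.mul (w.continuous.continuousOn.div continuousOn_id ?_)
      intro t ht
      rw [uIcc_of_le (by linarith)] at ht
      exact (hε0.trans_le ht.1).ne'
    · intro t ht
      have ht0 : 0 < t := hε0.trans ht.1
      have h1 := sq_eval_dirichletPoly_mul_le n ht0 ht.2
      rw [eval_mul, eval_pow]
      calc w.eval t * (dirichletPoly n).eval t ^ 2
          = w.eval t / t * ((dirichletPoly n).eval t ^ 2 * t) := by field_simp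
        _ ≤ w.eval t / t * (1 / (2 * n + 1 : ℝ) ^ 2) := by
            gcongr
            exact div_nonneg (hw t ⟨ht0.le, ht.2.le⟩) ht0.le
        _ = _ := mul_comm _ _
  rw [intervalIntegral.integral_const_mul] at hmono
  have hI : 0 ≤ ∫ t in ε..1, w.eval t / t := intervalIntegral.integral_nonneg (by linarith)
    fun t ht => div_nonneg (hw t ⟨hε0.le.trans ht.1, ht.2⟩) (hε0.le.trans ht.1)
  have hfrac : 4 * (m : ℝ) ^ 2 * (1 / (2 * n + 1 : ℝ) ^ 2) ≤ 16 := by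
    rw [mul_one_div, div_le_iff₀ (by positivity), hm]
    push_cast
    nlinarith [(Nat.cast_nonneg n : (0 : ℝ) ≤ n)]
  calc w.eval 0 ≤ 4 * (m : ℝ) ^ 2 * Real.exp 3 *
        (1 / (2 * n + 1 : ℝ) ^ 2 * ∫ t in ε..1, w.eval t / t) :=
        h.trans (mul_le_mul_of_nonneg_left hmono (by positivity))
    _ = 4 * (m : ℝ) ^ 2 * (1 / (2 * n + 1 : ℝ) ^ 2) * (Real.exp 3 * ∫ t in ε..1, w.eval t / t) := by
        ring
    _ ≤ 16 * (Real.exp 3 * ∫ t in ε..1, w.eval t / t) := by gcongr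
    _ = _ := by ring

/-! ### Growth of integrals under homotheties -/

/-- The restrictions of `W` to all lines are polynomials of degree at most `n`. -/
def IsPolyOnLines (n : ℕ) (W : E3 → ℝ) : Prop :=
  ∀ a b : E3, ∃ P : ℝ[X], P.natDegree ≤ n ∧ ∀ t : ℝ, P.eval t = W (a + t • b)

/-- Integrating a family of polynomials over its parameter gives a polynomial. -/
lemma exists_polynomial_eval_eq_integral {α : Type*} [MeasurableSpace α] {μ : Measure α} {n : ℕ}
    {f : ℝ → α → ℝ} (hpoly : ∀ a, ∃ P : ℝ[X], P.natDegree ≤ n ∧ ∀ t, P.eval t = f t a)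
    (hint : ∀ t, Integrable (f t) μ) :
    ∃ Q : ℝ[X], Q.natDegree ≤ n ∧ ∀ t, Q.eval t = ∫ a, f t a ∂μ := by
  have hinj : Set.InjOn (fun i : ℕ => (i : ℝ)) (Finset.range (n + 1)) :=
    fun i _ j _ h => Nat.cast_injective h
  refine ⟨Lagrange.interpolate (Finset.range (n + 1)) (fun i : ℕ => (i : ℝ))
    fun i => ∫ a, f i a ∂μ, ?_, fun t => ?_⟩
  · have := Lagrange.degree_interpolate_lt (r := fun i : ℕ => ∫ a, f i a ∂μ) hinj
    rw [Finset.card_range] at this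
    exact Polynomial.natDegree_le_iff_coeff_eq_zero.2 fun k hk =>
      coeff_eq_zero_of_degree_lt (this.trans_le (by exact_mod_cast hk))
  · have hf : ∀ a, f t a = ∑ i ∈ Finset.range (n + 1), f i a *
        (Lagrange.basis (Finset.range (n + 1)) (fun i : ℕ => (i : ℝ)) i).eval t := by
      intro a
      obtain ⟨P, hPd, hP⟩ := hpoly a
      have h := Lagrange.eq_interpolate_of_eval_eq (f := P) (fun i : ℕ => f i a) hinj (by
        rw [Finset.card_range]
        exact (natDegree_le_iff_degree_le.1 hPd).trans_lt (by exact_mod_cast Nat.lt_succ_self n))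
        (fun i _ => hP i)
      rw [← hP t, h]
      simp [Lagrange.interpolate_apply, eval_finsetSum]
    simp_rw [hf]
    rw [integral_finsetSum _ fun (i : ℕ) _ => (hint i).mul_const _]
    simp [Lagrange.interpolate_apply, eval_finsetSum, integral_mul_const]

lemma lintegral_comp_homothety {f : E3 → ℝ≥0∞} (hf : Measurable f) (a : E3) {t : ℝ} (ht : 0 < t) :
    ENNReal.ofReal (t ^ 3) * ∫⁻ y, f (a + t • (y - a)) = ∫⁻ z, f z := by
  have h1 : ∫⁻ y, f (a + t • (y - a)) = ∫⁻ y, f (a + t • y) :=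
    lintegral_sub_right_eq_self (fun y => f (a + t • y)) a
  have h2 : ∫⁻ y, f (a + t • y) = ∫⁻ y, f (a + y) ∂(Measure.map (t • ·) (volume : Measure E3)) := by
    rw [lintegral_map (f := fun y => f (a + y)) (hf.comp (measurable_const_add a))
      (measurable_const_smul t)]
  rw [h1, h2, Measure.map_addHaar_smul _ ht.ne', lintegral_smul_measure,
    lintegral_add_left_eq_self, smul_eq_mul, ← mul_assoc]
  have hfr : Module.finrank ℝ E3 = 3 := by simp
  rw [hfr, abs_of_pos (by positivity), ← ENNReal.ofReal_mul (by positivity),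
    mul_inv_cancel₀ (by positivity), ENNReal.ofReal_one, one_mul]

/-- Growth of the integral of a nonnegative polynomial over a star shaped set `E` under a homothety
with the center `a` that maps `E` into `G`. -/
lemma lintegral_le_growth_mul {n : ℕ} {W : E3 → ℝ} (hWc : Continuous W) (hW0 : ∀ x, 0 ≤ W x)
    (hWp : IsPolyOnLines n W) {E G : Set E3} {a : E3} {s : ℝ} (hs0 : 0 < s) (hs1 : s ≤ 1)
    (hE : MeasurableSet E) (hEb : Bornology.IsBounded E)
    (hstar : ∀ y ∈ E, ∀ σ : ℝ, 0 < σ → σ ≤ 1 → a + σ • (y - a) ∈ E)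
    (hG : ∀ y ∈ E, a + s • (y - a) ∈ G) :
    ∫⁻ x in E, ENNReal.ofReal (W x) ≤
      ENNReal.ofReal (growth (2 / s - 1) ^ (n + 3)) * ∫⁻ x in G, ENNReal.ofReal (W x) := by
  have hcont : ∀ σ : ℝ, Continuous fun y => W (a + σ • (y - a)) := fun σ => by fun_prop
  have hint : ∀ σ : ℝ, Integrable (fun y => W (a + σ • (y - a))) (volume.restrict E) := fun σ =>
    ((hcont σ).continuousOn.integrableOn_compact hEb.isCompact_closure).mono_set subset_closure
  obtain ⟨Q, hQd, hQ⟩ := exists_polynomial_eval_eq_integral (μ := volume.restrict E)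
    (f := fun σ y => W (a + σ • (y - a))) (fun y => hWp a (y - a)) hint
  have hQ0 : ∀ σ, 0 ≤ Q.eval σ := fun σ => by
    rw [hQ]; exact integral_nonneg fun y => hW0 _
  have hWm : Measurable fun x => ENNReal.ofReal (W x) := hWc.measurable.ennreal_ofReal
  have hof : ∀ σ, ENNReal.ofReal (Q.eval σ) =
      ∫⁻ y in E, ENNReal.ofReal (W (a + σ • (y - a))) := fun σ => by
    rw [hQ, ofReal_integral_eq_lintegral_ofReal (hint σ) (Filter.Eventually.of_forall fun y => hW0 _)]
  have himg : ∀ σ : ℝ, 0 < σ → ENNReal.ofReal (σ ^ 3 * Q.eval σ) =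
      ∫⁻ x in {x | a + σ⁻¹ • (x - a) ∈ E}, ENNReal.ofReal (W x) := fun σ hσ => by
    have hm : MeasurableSet {x : E3 | a + σ⁻¹ • (x - a) ∈ E} :=
      hE.preimage (f := fun x => a + σ⁻¹ • (x - a)) (Continuous.measurable (by fun_prop))
    rw [ENNReal.ofReal_mul (by positivity), hof, ← lintegral_indicator hE,
      ← lintegral_indicator hm, ← lintegral_comp_homothety (hWm.indicator hm) a hσ]
    congr 2
    ext y
    have : a + σ⁻¹ • (a + σ • (y - a) - a) = y := by
      rw [add_sub_cancel_left, smul_smul, inv_mul_cancel₀ hσ.ne', one_smul, add_sub_cancel]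
    by_cases hy : y ∈ E
    · rw [indicator_of_mem hy, indicator_of_mem]
      rw [mem_ofPred_eq, this]; exact hy
    · rw [indicator_of_notMem hy, indicator_of_notMem]
      rw [mem_ofPred_eq, this]; exact hy
  have hmono : ∀ σ ∈ Icc (0 : ℝ) s, |(X ^ 3 * Q).eval σ| ≤ s ^ 3 * Q.eval s := by
    intro σ hσ
    rw [eval_mul, eval_pow, eval_X, abs_of_nonneg (mul_nonneg (pow_nonneg hσ.1 3) (hQ0 σ))]
    rcases hσ.1.eq_or_lt with rfl | hσ0
    · simpa using mul_nonneg (pow_nonneg hs0.le 3) (hQ0 s)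
    rw [← ENNReal.ofReal_le_ofReal_iff (mul_nonneg (pow_nonneg hs0.le 3) (hQ0 s)), himg σ hσ0,
      himg s hs0]
    refine lintegral_mono_set fun x hx => ?_
    have := hstar _ hx (σ / s) (by positivity) (div_le_one_of_le₀ hσ.2 hs0.le)
    rw [add_sub_cancel_left, smul_smul, show σ / s * σ⁻¹ = s⁻¹ by field_simp] at this
    exact this
  have hgr := eval_one_le_growth_pow_mul (n := n + 3) (P := X ^ 3 * Q) hs0 hs1 (by
    refine natDegree_mul_le.trans ?_
    rw [natDegree_X_pow]; omega) hmono
  rw [eval_mul, eval_pow, eval_X, one_pow, one_mul] at hgr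
  have h2 : 1 ≤ 2 / s - 1 := by
    have : 2 ≤ 2 / s := by rw [le_div_iff₀ hs0]; linarith
    linarith
  calc ∫⁻ x in E, ENNReal.ofReal (W x) = ENNReal.ofReal (Q.eval 1) := by
        rw [hof]; simp
    _ ≤ ENNReal.ofReal (growth (2 / s - 1) ^ (n + 3) * (s ^ 3 * Q.eval s)) :=
        ENNReal.ofReal_le_ofReal hgr
    _ = ENNReal.ofReal (growth (2 / s - 1) ^ (n + 3)) * ENNReal.ofReal (s ^ 3 * Q.eval s) :=
        ENNReal.ofReal_mul (pow_nonneg (zero_le_one.trans (one_le_growth h2)) _)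
    _ ≤ _ := by
        gcongr
        rw [himg s hs0]
        refine lintegral_mono_set fun x hx => ?_
        have := hG _ hx
        rwa [add_sub_cancel_left, smul_smul, mul_inv_cancel₀ hs0.ne', one_smul,
          add_sub_cancel] at this

/-! ### The trace inequality for upper regular surfaces -/

lemma lintegral_one_div_sq_le {ε : ℝ} (h0 : 0 < ε) (h1 : ε ≤ 1) :
    ∫⁻ t in Ioc ε 1, ENNReal.ofReal (t ^ 2)⁻¹ ≤ ENNReal.ofReal (1 / ε) := by
  have hint : IntervalIntegrable (fun t : ℝ => (t ^ 2)⁻¹) volume ε 1 := by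
    refine ContinuousOn.intervalIntegrable (ContinuousOn.inv₀ (by fun_prop) fun t ht => ?_)
    rw [uIcc_of_le h1] at ht
    have : 0 < t := h0.trans_le ht.1
    positivity
  rw [← ofReal_integral_eq_lintegral_ofReal
    ((intervalIntegrable_iff_integrableOn_Ioc_of_le h1).1 hint)
    (Filter.Eventually.of_forall fun t => by positivity), ← intervalIntegral.integral_of_le h1]
  refine ENNReal.ofReal_le_ofReal ?_
  have := integral_zpow (a := ε) (b := 1) (n := -2) (Or.inr ⟨by norm_num, fun h => by
    rw [uIcc_of_le h1] at h; exact absurd h.1 (not_le.2 h0)⟩)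
  have e : ∀ t : ℝ, (t ^ 2)⁻¹ = t ^ (-2 : ℤ) := fun t => by
    rw [zpow_neg]; norm_cast
  simp_rw [e]
  rw [this]
  norm_num
  linarith

/-- Trace inequality for a convex set and an upper Ahlfors regular measure of dimension two on its
closure. Each point `x` is joined with all points `y` of the set; the pointwise bound
`eval_zero_le_integral_div` on these segments is averaged over `y`. The weight `1 / t` and the
distance `ε ∼ n⁻²` of the domain of integration to `x` make the sum over all scales converge,
without any transversality of the segments and the support of the measure. -/
lemma volume_mul_lintegral_closure_le {n : ℕ} {W : E3 → ℝ} (hWc : Continuous W)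
    (hW0 : ∀ x, 0 ≤ W x) (hWp : IsPolyOnLines n W) {E : Set E3} (hEo : IsOpen E)
    (hEc : Convex ℝ E) {h : ℝ} (hh : 0 < h) (hEh : ∀ x ∈ closure E, ∀ y ∈ E, dist y x ≤ h)
    {μ : Measure E3} {c : ℝ≥0∞} (hc : c ≠ ∞)
    (hμ : ∀ z r, 0 < r → μ (Metric.closedBall z r) ≤ c * ENNReal.ofReal (r ^ 2)) :
    volume E * ∫⁻ x in closure E, ENNReal.ofReal (W x) ∂μ ≤
      ENNReal.ofReal (64 * Real.exp 3 * ((3 * n + 1 : ℕ) : ℝ) ^ 2 * h ^ 2) * c *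
        ∫⁻ x in E, ENNReal.ofReal (W x) := by
  rcases E.eq_empty_or_nonempty with rfl | ⟨y₀, hy₀⟩
  · simp
  set m : ℝ := ((3 * n + 1 : ℕ) : ℝ) with hm
  have hm1 : 1 ≤ m := by rw [hm]; exact_mod_cast (by omega : 1 ≤ 3 * n + 1)
  obtain ⟨ε, hε⟩ : ∃ ε : ℝ, ε = 1 / (4 * m ^ 2) := ⟨_, rfl⟩
  have hm2 : 1 ≤ m ^ 2 := one_le_pow₀ hm1
  have hε0 : 0 < ε := by rw [hε]; positivity
  have hε1 : ε ≤ 1 := by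
    rw [hε]; exact div_le_one_of_le₀ (by linarith) (by positivity)
  set ν := μ.restrict (closure E) with hν
  have hfin : IsFiniteMeasure ν := by
    refine ⟨?_⟩
    rw [hν, Measure.restrict_apply_univ]
    refine lt_of_le_of_lt (measure_mono fun x hx => ?_) ((hμ y₀ h hh).trans_lt
      (ENNReal.mul_lt_top hc.lt_top ENNReal.ofReal_lt_top))
    rw [Metric.mem_closedBall, dist_comm]; exact hEh x hx y₀ hy₀
  set k : ℝ≥0∞ := ENNReal.ofReal (16 * Real.exp 3) with hk
  set φ : ℝ → E3 → E3 → ℝ≥0∞ := fun t x y =>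
    ENNReal.ofReal t⁻¹ * ENNReal.ofReal (W (x + t • (y - x))) with hφ
  have hWm : Measurable fun x => ENNReal.ofReal (W x) := hWc.measurable.ennreal_ofReal
  have hφm : Measurable fun q : ℝ × E3 × E3 => φ q.1 q.2.1 q.2.2 := by
    refine (measurable_fst.inv.ennreal_ofReal).mul (hWm.comp (Continuous.measurable ?_))
    fun_prop
  -- the pointwise bound on the segment from `x` to `y`
  have hpt : ∀ x y, ENNReal.ofReal (W x) ≤ k * ∫⁻ t in Ioc ε 1, φ t x y := by
    intro x y
    obtain ⟨P, hPd, hP⟩ := hWp x (y - x)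
    have h1 := eval_zero_le_integral_div hPd (fun t _ => by rw [hP]; exact hW0 _) (hε.trans (by rw [hm]))
    have hint : IntervalIntegrable (fun t : ℝ => P.eval t / t) volume ε 1 := by
      refine ContinuousOn.intervalIntegrable (P.continuous.continuousOn.div continuousOn_id ?_)
      intro t ht
      rw [uIcc_of_le hε1] at ht
      exact (hε0.trans_le ht.1).ne'
    rw [hP, zero_smul, add_zero, intervalIntegral.integral_of_le hε1] at h1
    refine (ENNReal.ofReal_le_ofReal h1).trans (le_of_eq ?_)
    rw [ENNReal.ofReal_mul (by positivity), ofReal_integral_eq_lintegral_ofReal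
      ((intervalIntegrable_iff_integrableOn_Ioc_of_le hε1).1 hint)]
    · congr 1
      refine setLIntegral_congr_fun measurableSet_Ioc fun t ht => ?_
      simp only [hφ]
      have : 0 < t := hε0.trans ht.1
      rw [hP, div_eq_inv_mul, ENNReal.ofReal_mul (by positivity)]
    · refine (ae_restrict_iff' measurableSet_Ioc).2 (Filter.Eventually.of_forall fun t ht => ?_)
      simp only [hP]
      exact div_nonneg (hW0 _) (hε0.trans ht.1).le
  -- the average over `x` and `y` for a fixed ratio `t`
  have hav : ∀ t ∈ Ioc ε 1, ∫⁻ x, (∫⁻ y in E, φ t x y) ∂ν ≤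
      ENNReal.ofReal (t ^ 2)⁻¹ * (c * ENNReal.ofReal (h ^ 2) * ∫⁻ z in E, ENNReal.ofReal (W z)) := by
    intro t ht
    have ht0 : 0 < t := hε0.trans ht.1
    set ψ : E3 → E3 → ℝ≥0∞ := fun x z =>
      (Metric.closedBall z (t * h)).indicator (fun _ => ENNReal.ofReal (W z)) x with hψ
    have hψm : Measurable (Function.uncurry ψ) := by
      have : Function.uncurry ψ = ({q : E3 × E3 | dist q.1 q.2 ≤ t * h}).indicator
          (fun q => ENNReal.ofReal (W q.2)) := by
        ext ⟨x, z⟩; simp [hψ, indicator]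
      rw [this]
      refine (hWm.comp measurable_snd).indicator ?_
      exact (isClosed_le (by fun_prop) (by fun_prop)).measurableSet
    have hin : ∀ x ∈ closure E, ENNReal.ofReal (t ^ 3) * ∫⁻ y in E, φ t x y ≤
        ENNReal.ofReal t⁻¹ * ∫⁻ z in E, ψ x z := by
      intro x hx
      have hψx : Measurable (ψ x) := hψm.of_uncurry_left
      simp only [hφ]
      rw [lintegral_const_mul _ (f := fun y => ENNReal.ofReal (W (x + t • (y - x))))
        (hWm.comp (Continuous.measurable (by fun_prop))), mul_left_comm]
      gcongr
      rw [← lintegral_indicator hEo.measurableSet, ← lintegral_indicator hEo.measurableSet,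
        ← lintegral_comp_homothety (hψx.indicator hEo.measurableSet) x ht0]
      gcongr with y
      by_cases hy : y ∈ E
      · have hmem : x + t • (y - x) ∈ E := by
          have := hEc.combo_closure_interior_mem_interior hx (by rwa [hEo.interior_eq] : y ∈ interior E)
            (a := 1 - t) (b := t) (by linarith [ht.2]) ht0 (by ring)
          rw [hEo.interior_eq] at this
          convert this using 1
          module
        rw [indicator_of_mem hy, indicator_of_mem hmem]
        simp only [hψ]
        rw [indicator_of_mem]
        rw [Metric.mem_closedBall, dist_eq_norm, sub_add_cancel_left, norm_neg, norm_smul,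
          Real.norm_eq_abs, abs_of_pos ht0, ← dist_eq_norm]
        exact mul_le_mul_of_nonneg_left (hEh x hx y hy) ht0.le
      · rw [indicator_of_notMem hy]; exact zero_le
    have hpos : ENNReal.ofReal (t ^ 3) ≠ 0 := by
      rw [Ne, ENNReal.ofReal_eq_zero, not_le]; positivity
    rw [← ENNReal.mul_le_mul_iff_right hpos ENNReal.ofReal_ne_top]
    have hφt : Measurable fun x => ∫⁻ y in E, φ t x y :=
      Measurable.lintegral_prod_right' (f := fun q : E3 × E3 => φ t q.1 q.2)
        (hφm.comp (measurable_const.prodMk measurable_id))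
    calc ENNReal.ofReal (t ^ 3) * ∫⁻ x, (∫⁻ y in E, φ t x y) ∂ν
        = ∫⁻ x, (ENNReal.ofReal (t ^ 3) * ∫⁻ y in E, φ t x y) ∂ν :=
          (lintegral_const_mul _ hφt).symm
      _ ≤ ∫⁻ x, (ENNReal.ofReal t⁻¹ * ∫⁻ z in E, ψ x z) ∂ν :=
          setLIntegral_mono' isClosed_closure.measurableSet hin
      _ = ENNReal.ofReal t⁻¹ * ∫⁻ x, (∫⁻ z in E, ψ x z) ∂ν :=
          lintegral_const_mul _ hψm.lintegral_prod_right'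
      _ = ENNReal.ofReal t⁻¹ * ∫⁻ z in E, ∫⁻ x, ψ x z ∂ν := by
          rw [lintegral_lintegral_swap hψm.aemeasurable]
      _ ≤ ENNReal.ofReal t⁻¹ * ∫⁻ z in E, c * ENNReal.ofReal ((t * h) ^ 2) *
            ENNReal.ofReal (W z) := by
          gcongr with z
          simp only [hψ]
          rw [lintegral_indicator Metric.isClosed_closedBall.measurableSet, setLIntegral_const,
            mul_comm]
          gcongr
          exact (Measure.restrict_apply_le _ _).trans (hμ z _ (by positivity))
      _ = ENNReal.ofReal t⁻¹ * (c * ENNReal.ofReal ((t * h) ^ 2) *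
            ∫⁻ z in E, ENNReal.ofReal (W z)) := by rw [lintegral_const_mul _ hWm]
      _ = ENNReal.ofReal (t⁻¹ * (t * h) ^ 2) * (c * ∫⁻ z in E, ENNReal.ofReal (W z)) := by
          rw [ENNReal.ofReal_mul (by positivity)]; ring
      _ = ENNReal.ofReal (t ^ 3 * (t ^ 2)⁻¹ * h ^ 2) * (c * ∫⁻ z in E, ENNReal.ofReal (W z)) := by
          congr 2; field_simp
      _ = _ := by
          rw [ENNReal.ofReal_mul (by positivity), ENNReal.ofReal_mul (by positivity)]; ring
  have hφ2 : ∀ x, Measurable (Function.uncurry fun y t => φ t x y) := fun x =>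
    hφm.comp (measurable_snd.prodMk (measurable_const.prodMk measurable_fst))
  have hφ3 : Measurable (Function.uncurry fun x t => ∫⁻ y in E, φ t x y) :=
    Measurable.lintegral_prod_right' (f := fun q : (E3 × ℝ) × E3 => φ q.1.2 q.1.1 q.2)
      (hφm.comp (measurable_fst.snd.prodMk (measurable_fst.fst.prodMk measurable_snd)))
  calc volume E * ∫⁻ x, ENNReal.ofReal (W x) ∂ν
      = ∫⁻ x, volume E * ENNReal.ofReal (W x) ∂ν := (lintegral_const_mul _ hWm).symm
    _ ≤ ∫⁻ x, (k * ∫⁻ t in Ioc ε 1, ∫⁻ y in E, φ t x y) ∂ν := by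
        refine lintegral_mono fun x => ?_
        calc volume E * ENNReal.ofReal (W x) = ∫⁻ y in E, ENNReal.ofReal (W x) := by
              rw [setLIntegral_const, mul_comm]
          _ ≤ ∫⁻ y in E, k * ∫⁻ t in Ioc ε 1, φ t x y := lintegral_mono fun y => hpt x y
          _ = k * ∫⁻ y in E, ∫⁻ t in Ioc ε 1, φ t x y :=
              lintegral_const_mul _ (hφ2 x).lintegral_prod_right'
          _ = _ := by rw [lintegral_lintegral_swap (hφ2 x).aemeasurable]
    _ = k * ∫⁻ x, (∫⁻ t in Ioc ε 1, ∫⁻ y in E, φ t x y) ∂ν :=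
        lintegral_const_mul _ hφ3.lintegral_prod_right'
    _ = k * ∫⁻ t in Ioc ε 1, ∫⁻ x, (∫⁻ y in E, φ t x y) ∂ν := by
        rw [lintegral_lintegral_swap hφ3.aemeasurable]
    _ ≤ k * ∫⁻ t in Ioc ε 1, ENNReal.ofReal (t ^ 2)⁻¹ *
          (c * ENNReal.ofReal (h ^ 2) * ∫⁻ z in E, ENNReal.ofReal (W z)) := by
        gcongr 1
        exact setLIntegral_mono' measurableSet_Ioc hav
    _ = k * ((∫⁻ t in Ioc ε 1, ENNReal.ofReal (t ^ 2)⁻¹) *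
          (c * ENNReal.ofReal (h ^ 2) * ∫⁻ z in E, ENNReal.ofReal (W z))) := by
        rw [lintegral_mul_const _ (by fun_prop)]
    _ ≤ k * (ENNReal.ofReal (1 / ε) *
          (c * ENNReal.ofReal (h ^ 2) * ∫⁻ z in E, ENNReal.ofReal (W z))) := by
        gcongr
        exact lintegral_one_div_sq_le hε0 hε1
    _ = _ := by
        rw [hk, show 64 * Real.exp 3 * m ^ 2 * h ^ 2 = 16 * Real.exp 3 * (1 / ε) * h ^ 2 by
          rw [hε]; field_simp; ring, ENNReal.ofReal_mul (p := 16 * Real.exp 3 * (1 / ε)) (by positivity),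
          ENNReal.ofReal_mul (p := 16 * Real.exp 3) (by positivity)]
        ring

/-! ### The square of a polynomial on lines -/

section Square

variable {𝕜 : Type*} [RCLike 𝕜]

lemma continuous_polyFun (v : MvPolynomial (Fin 3) 𝕜) : Continuous (polyFun v) := by
  unfold polyFun
  refine (MvPolynomial.continuous_eval v).comp ?_
  fun_prop

lemma exists_polynomial_eval_eq_normSq {n : ℕ} (P : 𝕜[X]) (hP : P.natDegree ≤ n) :
    ∃ Q : ℝ[X], Q.natDegree ≤ 2 * n ∧ ∀ t : ℝ, Q.eval t = ‖P.eval (t : 𝕜)‖ ^ 2 := by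
  have key : ∀ L : 𝕜 →ₗ[ℝ] ℝ, ∃ Q : ℝ[X], Q.natDegree ≤ n ∧ ∀ t : ℝ, Q.eval t = L (P.eval (t : 𝕜)) := by
    intro L
    refine ⟨∑ k ∈ Finset.range (n + 1), monomial k (L (P.coeff k)), ?_, fun t => ?_⟩
    · refine natDegree_sum_le_of_forall_le _ _ fun k hk => (natDegree_monomial_le _).trans ?_
      exact Nat.lt_succ_iff.1 (Finset.mem_range.1 hk)
    · rw [eval_eq_sum_range' (Nat.lt_succ_of_le hP), map_sum, eval_finsetSum]
      refine Finset.sum_congr rfl fun k _ => ?_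
      rw [eval_monomial, mul_comm (P.coeff k), ← RCLike.ofReal_pow, ← RCLike.real_smul_eq_coe_mul,
        map_smul, smul_eq_mul, mul_comm]
  obtain ⟨Q₁, h₁, hQ₁⟩ := key RCLike.reLm
  obtain ⟨Q₂, h₂, hQ₂⟩ := key RCLike.imLm
  refine ⟨Q₁ ^ 2 + Q₂ ^ 2, ?_, fun t => ?_⟩
  · refine (natDegree_add_le _ _).trans (max_le ?_ ?_) <;> refine natDegree_pow_le.trans ?_ <;> gcongr
  · rw [RCLike.norm_sq_eq_def, eval_add, eval_pow, eval_pow, hQ₁, hQ₂, sq, sq]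
    rfl

/-- A polynomial of degree at most `p` in each variable has total degree at most `3p`. -/
lemma isPolyOnLines_normSq_polyFun {p : ℕ} {v : MvPolynomial (Fin 3) 𝕜} (hv : IsQ p v) :
    IsPolyOnLines (6 * p) fun x => ‖polyFun v x‖ ^ 2 := by
  intro a b
  have htot : v.totalDegree ≤ 3 * p := by
    refine Finset.sup_le fun m hm => ?_
    rw [Finsupp.sum_fintype _ _ fun _ => rfl]
    calc ∑ i, m i ≤ ∑ _i : Fin 3, p :=
          Finset.sum_le_sum fun i _ => (MvPolynomial.monomial_le_degreeOf i hm).trans (hv i)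
      _ = 3 * p := by simp
  obtain ⟨Q, hQd, hQ⟩ := exists_polynomial_eval_eq_normSq (n := 3 * p)
    (MvPolynomial.aeval (fun k => C ((a k : ℝ) : 𝕜) + X * C ((b k : ℝ) : 𝕜)) v) (by
      refine (MvPolynomial.aeval_natDegree_le v htot _ (n := 1) fun k => ?_).trans (by omega)
      refine (natDegree_add_le _ _).trans (max_le (by simp) (natDegree_mul_le.trans ?_))
      rw [natDegree_C, add_zero]
      exact natDegree_X_le)
  refine ⟨Q, hQd.trans (by omega), fun t => ?_⟩
  rw [hQ]
  congr 2
  rw [polyFun, ← coe_evalRingHom, MvPolynomial.map_aeval]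
  simp only [MvPolynomial.eval]
  congr 1
  ext k
  · simp
  · simp only [eval_add, eval_mul, eval_C, eval_X, coe_evalRingHom, PiLp.add_apply, PiLp.smul_apply,
      smul_eq_mul, RCLike.ofReal_add, RCLike.ofReal_mul]
    rw [MvPolynomial.eval₂Hom_X', MvPolynomial.eval₂Hom_X']

end Square

/-! ### Right hexahedra -/

namespace Hexahedron

variable (K : Hexahedron)

lemma homothety_mem_carrier {x y : E3} (hx : x ∈ K.closed) (hy : y ∈ K.carrier) {t : ℝ}
    (ht0 : 0 < t) (ht1 : t ≤ 1) : x + t • (y - x) ∈ K.carrier := by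
  intro k
  have h1 := hx k
  have h2 := hy k
  simp only [PiLp.add_apply, PiLp.smul_apply, PiLp.sub_apply, smul_eq_mul]
  constructor <;> nlinarith [mul_nonneg (sub_nonneg.2 ht1) (sub_nonneg.2 h1.1),
    mul_nonneg (sub_nonneg.2 ht1) (sub_nonneg.2 h1.2), mul_pos ht0 (sub_pos.2 h2.1),
    mul_pos ht0 (sub_pos.2 h2.2)]

lemma isOpen_carrier : IsOpen K.carrier := by
  have : K.carrier = ⋂ k, ({x : E3 | K.lo k < x k} ∩ {x : E3 | x k < K.hi k}) := by
    ext x; simp [carrier]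
  rw [this]
  refine isOpen_iInter_of_finite fun k => ?_
  exact (isOpen_lt (by fun_prop) (by fun_prop)).inter (isOpen_lt (by fun_prop) (by fun_prop))

lemma isClosed_closed : IsClosed K.closed := by
  have : K.closed = ⋂ k, ({x : E3 | K.lo k ≤ x k} ∩ {x : E3 | x k ≤ K.hi k}) := by
    ext x; simp [closed]
  rw [this]
  refine isClosed_iInter fun k => ?_
  exact (isClosed_le (by fun_prop) (by fun_prop)).inter (isClosed_le (by fun_prop) (by fun_prop))

lemma carrier_subset_closed : K.carrier ⊆ K.closed := fun _ hx k => ⟨(hx k).1.le, (hx k).2.le⟩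

lemma vertices_subset_closed : K.vertices ⊆ K.closed := fun x hx k => by
  have := (K.lo_lt_hi k).le
  rcases hx k with h | h <;> rw [h] <;> constructor <;> linarith

lemma convex_carrier : Convex ℝ K.carrier := by
  intro x hx y hy a b ha hb hab
  rcases hb.eq_or_lt with rfl | hb'
  · rw [add_zero] at hab; subst hab; simpa using hx
  have := K.homothety_mem_carrier (K.carrier_subset_closed hx) hy hb' (by linarith)
  convert this using 1
  rw [← eq_sub_iff_add_eq] at hab
  rw [hab]; module

lemma carrier_nonempty : K.carrier.Nonempty := by
  refine ⟨WithLp.toLp 2 fun k => (K.lo k + K.hi k) / 2, fun k => ?_⟩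
  have := K.lo_lt_hi k
  simp only
  constructor <;> linarith

lemma closure_carrier : closure K.carrier = K.closed := by
  refine subset_antisymm (closure_minimal K.carrier_subset_closed K.isClosed_closed) fun x hx => ?_
  obtain ⟨y, hy⟩ := K.carrier_nonempty
  have hlim : Filter.Tendsto (fun t : ℝ => x + t • (y - x)) (nhdsWithin 0 (Ioi 0)) (nhds x) := by
    have hc : Continuous fun t : ℝ => x + t • (y - x) := by fun_prop
    have := (hc.tendsto 0).mono_left (nhdsWithin_le_nhds (s := Ioi (0 : ℝ)))
    simpa using this
  refine mem_closure_of_tendsto hlim ?_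
  filter_upwards [Ioc_mem_nhdsGT (zero_lt_one' ℝ)] with t ht
  exact K.homothety_mem_carrier hx hy ht.1 ht.2

lemma isBounded_carrier : Bornology.IsBounded K.carrier := by
  have h := (PiLp.antilipschitzWith_ofLp 2 fun _ : Fin 3 => ℝ).isBounded_preimage
    (Metric.isBounded_Icc (WithLp.ofLp K.lo) (WithLp.ofLp K.hi))
  exact h.subset fun x hx => ⟨fun k => (hx k).1.le, fun k => (hx k).2.le⟩

lemma dist_le_size {x y : E3} (hx : x ∈ K.closed) (hy : y ∈ K.closed) : dist x y ≤ K.size := by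
  rw [size, ← Metric.diam_closure, closure_carrier]
  exact Metric.dist_le_diam_of_mem (by rw [← closure_carrier]; exact K.isBounded_carrier.closure) hx hy

lemma size_pos : 0 < K.size := by
  rw [size, ← Metric.diam_closure, closure_carrier]
  refine Metric.diam_pos ⟨K.lo, ?_, K.hi, ?_, ?_⟩ (by
    rw [← closure_carrier]; exact K.isBounded_carrier.closure)
  · exact fun k => ⟨le_rfl, (K.lo_lt_hi k).le⟩
  · exact fun k => ⟨(K.lo_lt_hi k).le, le_rfl⟩
  · intro h
    have := K.lo_lt_hi 0
    rw [h] at this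
    exact lt_irrefl _ this

lemma volume_carrier : volume K.carrier = ∏ k, ENNReal.ofReal (K.hi k - K.lo k) := by
  rw [← Real.volume_pi_Ioo, ← (PiLp.volume_preserving_ofLp (Fin 3)).measure_preimage
    (MeasurableSet.univ_pi fun _ => measurableSet_Ioo).nullMeasurableSet]
  congr 1
  ext x
  simp [carrier]

lemma le_volume_carrier {r : ℝ} (hr : 0 ≤ r) (hK : ∀ k, r ≤ K.hi k - K.lo k) :
    ENNReal.ofReal (r ^ 3) ≤ volume K.carrier := by
  rw [volume_carrier, ENNReal.ofReal_pow hr]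
  calc ENNReal.ofReal r ^ 3 = ∏ _k : Fin 3, ENNReal.ofReal r := by simp
    _ ≤ _ := Finset.prod_le_prod' fun k _ => ENNReal.ofReal_le_ofReal (hK k)

end Hexahedron

/-! ### Pieces of a hexahedron near a plane -/

/-- A convex set that does not meet the boundary of an open set lies inside it or outside it. -/
lemma Convex.subset_or_disjoint_of_frontier {C U : Set E3} (hC : Convex ℝ C) (hU : IsOpen U)
    (h : ∀ x ∈ C, x ∉ frontier U) : C ⊆ U ∨ Disjoint C U := by
  have hd : Disjoint U (closure U)ᶜ := disjoint_compl_right.mono_left subset_closure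
  rcases hC.isPreconnected.subset_or_subset hU isClosed_closure.isOpen_compl hd (fun x hx => by
    by_cases hxU : x ∈ U
    · exact Or.inl hxU
    · refine Or.inr fun hx' => h x hx ?_
      rw [hU.frontier_eq]
      exact ⟨hx', hxU⟩) with h | h
  · exact Or.inl h
  · exact Or.inr (hd.symm.mono_left h)

lemma volume_level_eq_zero (L : E3 →L[ℝ] ℝ) {a : E3} {r : ℝ} (ha : L a ≠ r) :
    volume {x | L x = r} = 0 := by
  have h := Measure.addHaar_affineSubspace (volume : Measure E3)
    (AffineSubspace.comap (L : E3 →ₗ[ℝ] ℝ).toAffineMap (affineSpan ℝ {r})) (by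
      intro h
      have : a ∈ AffineSubspace.comap (L : E3 →ₗ[ℝ] ℝ).toAffineMap (affineSpan ℝ {r}) := by
        rw [h]; trivial
      rw [AffineSubspace.mem_comap, AffineSubspace.mem_affineSpan_singleton] at this
      exact ha this)
  convert h using 2
  ext x
  rw [SetLike.mem_coe, AffineSubspace.mem_comap, AffineSubspace.mem_affineSpan_singleton]
  rfl

/-- Let the plane `L = c` separate the vertex `A` of `K` from the part of `K` with `L - c < -d`, and
let the boundary of `U` inside `K` have distance at most `d` to this plane. Then `K ∩ U` is contained
in a convex subset `E` of `K` with a volume comparable to that of `K` such that the integrals of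
polynomials over `E` are controlled by those over `K ∩ U`. -/
lemma exists_convex_superset {K : Hexahedron} {U : Set E3} (hU : IsOpen U) {A : E3}
    (hA : A ∈ K.vertices) (hAU : A ∈ U) (L : E3 →L[ℝ] ℝ) (c : ℝ) {d η : ℝ} (hd : 0 ≤ d)
    (hη0 : 0 ≤ η) (hη : η ≤ 1 / 2) (hD : 0 < L A - c) (hdη : d ≤ η * (L A - c))
    (hfr : ∀ x ∈ K.carrier, x ∈ frontier U → |L x - c| ≤ d)
    {δ₀ : ℝ} (hδ₀ : 0 < δ₀) (hδ₁ : δ₀ < 1 / 2)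
    (hlarge : ∀ a b, K.IsEdge a b → (segment ℝ a b ∩ U).Nonempty →
      ENNReal.ofReal δ₀ ≤ volume {t : ℝ | t ∈ Icc (0 : ℝ) 1 ∧ AffineMap.lineMap a b t ∈ U}) :
    ∃ E : Set E3, IsOpen E ∧ Convex ℝ E ∧ E ⊆ K.carrier ∧ K.carrier ∩ U ⊆ E ∧
      ENNReal.ofReal ((δ₀ / 3) ^ 3) * volume K.carrier ≤ volume E ∧
      ∀ (n : ℕ) (W : E3 → ℝ), Continuous W → (∀ x, 0 ≤ W x) → IsPolyOnLines n W →
        ∫⁻ x in E, ENNReal.ofReal (W x) ≤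
          ENNReal.ofReal (2 * growth ((1 + 3 * η) / (1 - η)) ^ (n + 3)) *
            ∫⁻ x in K.carrier ∩ U, ENNReal.ofReal (W x) := by
  have hAc : A ∈ K.closed := K.vertices_subset_closed hA
  have hAcl : A ∈ closure K.carrier := by rw [K.closure_carrier]; exact hAc
  set D := L A - c with hDdef
  have hLh : ∀ (y : E3) (t : ℝ), L (A + t • (y - A)) - c = D + t * (L y - c - D) := by
    intro y t
    rw [map_add, map_smul, map_sub, hDdef, smul_eq_mul]; ring
  have hdD : d ≤ D / 2 := by nlinarith
  set G : Set E3 := {x | x ∈ K.carrier ∧ d < L x - c}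
  set H : Set E3 := {x | x ∈ K.carrier ∧ L x - c < -d}
  set E : Set E3 := {x | x ∈ K.carrier ∧ -d < L x - c}
  have hopen : ∀ r, IsOpen {x : E3 | r < L x - c} := fun r => isOpen_lt (by fun_prop) (by fun_prop)
  have hopen' : ∀ r, IsOpen {x : E3 | L x - c < r} := fun r => isOpen_lt (by fun_prop) (by fun_prop)
  have hconv : ∀ r, Convex ℝ {x : E3 | r < L x - c} := fun r => by
    have e : {x : E3 | r < L x - c} = {x | r + c < L x} := by
      ext x; simp only [mem_ofPred_eq, lt_sub_iff_add_lt]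
    rw [e]
    exact convex_halfSpace_gt L.isLinear (r + c)
  have hconv' : ∀ r, Convex ℝ {x : E3 | L x - c < r} := fun r => by
    have e : {x : E3 | L x - c < r} = {x | L x < r + c} := by
      ext x; simp only [mem_ofPred_eq, sub_lt_iff_lt_add]
    rw [e]
    exact convex_halfSpace_lt L.isLinear (r + c)
  have hGc : Convex ℝ G := K.convex_carrier.inter (hconv d)
  have hHc : Convex ℝ H := K.convex_carrier.inter (hconv' (-d))
  have hEc : Convex ℝ E := K.convex_carrier.inter (hconv (-d))
  have hEo : IsOpen E := K.isOpen_carrier.inter (hopen (-d))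
  have hGU : G ⊆ U := by
    rcases Convex.subset_or_disjoint_of_frontier hGc hU (fun x hx hxf => by
      have := (abs_le.1 (hfr x hx.1 hxf)).2
      linarith [hx.2]) with h | h
    · exact h
    · exfalso
      obtain ⟨y, ⟨hyU, hyd⟩, hyK⟩ := mem_closure_iff.1 hAcl (U ∩ {x | d < L x - c})
        (hU.inter (hopen d)) ⟨hAU, by show d < D; linarith⟩
      exact disjoint_left.1 h ⟨hyK, hyd⟩ hyU
  have hHU := Convex.subset_or_disjoint_of_frontier hHc hU (fun x hx hxf => by
      have := (abs_le.1 (hfr x hx.1 hxf)).1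
      linarith [hx.2])
  -- the homothety with center `A` and ratio `(1 - η) / (1 + η)` maps `E` into `G`
  have hgr : 1 ≤ growth ((1 + 3 * η) / (1 - η)) := by
    refine one_le_growth ?_
    rw [le_div_iff₀ (by linarith)]; linarith
  have hEW : ∀ (n : ℕ) (W : E3 → ℝ), Continuous W → (∀ x, 0 ≤ W x) → IsPolyOnLines n W →
      ∫⁻ x in E, ENNReal.ofReal (W x) ≤
        ENNReal.ofReal (growth ((1 + 3 * η) / (1 - η)) ^ (n + 3)) *
          ∫⁻ x in K.carrier ∩ U, ENNReal.ofReal (W x) := by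
    intro n W hWc hW0 hWp
    have hs0 : 0 < (1 - η) / (1 + η) := div_pos (by linarith) (by linarith)
    have hs1 : (1 - η) / (1 + η) ≤ 1 := by rw [div_le_one (by linarith)]; linarith
    have hsm : (1 - η) / (1 + η) * (1 + η) = 1 - η := div_mul_cancel₀ _ (by linarith)
    have h := lintegral_le_growth_mul hWc hW0 hWp (E := E) (G := K.carrier ∩ U) (a := A) hs0 hs1
      hEo.measurableSet (K.isBounded_carrier.subset fun x hx => hx.1) (fun y hy σ hσ0 hσ1 => by
        refine ⟨K.homothety_mem_carrier hAc hy.1 hσ0 hσ1, ?_⟩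
        rw [hLh]
        nlinarith [mul_pos hσ0 (sub_pos.2 hy.2), mul_nonneg (sub_nonneg.2 hσ1) hD.le,
          mul_nonneg (sub_nonneg.2 hσ1) hd]) (fun y hy => by
        have hm : A + ((1 - η) / (1 + η)) • (y - A) ∈ G := by
          refine ⟨K.homothety_mem_carrier hAc hy.1 hs0 hs1, ?_⟩
          rw [hLh]
          set s := (1 - η) / (1 + η)
          nlinarith [mul_pos hs0 (sub_pos.2 hy.2), mul_nonneg hs0.le (sub_nonneg.2 hdη)]
        exact ⟨hm.1, hGU hm⟩)
    have e : 2 / ((1 - η) / (1 + η)) - 1 = (1 + 3 * η) / (1 - η) := by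
      have h1 : 1 - η ≠ 0 := by linarith
      have h2 : 1 + η ≠ 0 := by linarith
      field_simp
      ring
    rwa [e] at h
  rcases hHU with hHU | hHU
  · -- both sides of the plane are in `U`
    refine ⟨K.carrier, K.isOpen_carrier, K.convex_carrier, subset_rfl, inter_subset_left, ?_, ?_⟩
    · refine mul_le_of_le_one_left' ?_
      rw [← ENNReal.ofReal_one]
      refine ENNReal.ofReal_le_ofReal (pow_le_one₀ (by positivity) (by linarith))
    · intro n W hWc hW0 hWp
      have hsub : K.carrier ⊆ (E ∪ K.carrier ∩ U) ∪ {x | L x = c - d} := by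
        intro x hx
        rcases lt_trichotomy (L x - c) (-d) with h | h | h
        · exact Or.inl (Or.inr ⟨hx, hHU ⟨hx, h⟩⟩)
        · exact Or.inr (by show L x = c - d; linarith)
        · exact Or.inl (Or.inl ⟨hx, h⟩)
      have hz : volume {x : E3 | L x = c - d} = 0 :=
        volume_level_eq_zero L (a := A) (by intro h; linarith)
      calc ∫⁻ x in K.carrier, ENNReal.ofReal (W x)
          ≤ ∫⁻ x in (E ∪ K.carrier ∩ U) ∪ {x | L x = c - d}, ENNReal.ofReal (W x) :=
            lintegral_mono_set hsub
        _ ≤ (∫⁻ x in E ∪ K.carrier ∩ U, ENNReal.ofReal (W x)) +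
            ∫⁻ x in {x | L x = c - d}, ENNReal.ofReal (W x) := lintegral_union_le _ _ _
        _ = ∫⁻ x in E ∪ K.carrier ∩ U, ENNReal.ofReal (W x) := by
            rw [setLIntegral_measure_zero _ _ hz, add_zero]
        _ ≤ (∫⁻ x in E, ENNReal.ofReal (W x)) + ∫⁻ x in K.carrier ∩ U, ENNReal.ofReal (W x) :=
            lintegral_union_le _ _ _
        _ ≤ ENNReal.ofReal (growth ((1 + 3 * η) / (1 - η)) ^ (n + 3)) *
              (∫⁻ x in K.carrier ∩ U, ENNReal.ofReal (W x)) +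
            ENNReal.ofReal (growth ((1 + 3 * η) / (1 - η)) ^ (n + 3)) *
              ∫⁻ x in K.carrier ∩ U, ENNReal.ofReal (W x) := by
            refine add_le_add (hEW n W hWc hW0 hWp) (le_mul_of_one_le_left' ?_)
            rw [← ENNReal.ofReal_one]
            exact ENNReal.ofReal_le_ofReal (one_le_pow₀ hgr)
        _ = _ := by
            rw [ENNReal.ofReal_mul zero_le_two, ← two_mul, ENNReal.ofReal_ofNat, mul_assoc]
  · refine ⟨E, hEo, hEc, fun x hx => hx.1, ?_, ?_, ?_⟩
    · rintro x ⟨hxK, hxU⟩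
      refine ⟨hxK, ?_⟩
      by_contra hle
      rw [not_lt] at hle
      -- move `x` away from `A`, so that it gets into `H`
      have hc : Continuous fun t : ℝ => A + t • (x - A) := by fun_prop
      have hnh : (fun t : ℝ => A + t • (x - A)) ⁻¹' (K.carrier ∩ U) ∈ nhdsWithin (1 : ℝ) (Ioi 1) := by
        refine nhdsWithin_le_nhds (hc.continuousAt.preimage_mem_nhds ?_)
        refine (K.isOpen_carrier.inter hU).mem_nhds ?_
        simpa using ⟨hxK, hxU⟩
      obtain ⟨t, ht, ht1⟩ := Filter.nonempty_of_mem (Filter.inter_mem hnh self_mem_nhdsWithin)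
      rw [mem_Ioi] at ht1
      refine disjoint_left.1 hHU (show A + t • (x - A) ∈ H from ⟨ht.1, ?_⟩) ht.2
      rw [hLh]
      nlinarith
    · -- the corner of `K` at `A` is contained in `E`
      have hcorner : ∀ k, -d ≤ D + δ₀ * L (EuclideanSpace.single k (K.lo k + K.hi k - 2 * A k)) := by
        intro k
        set b : E3 := A + EuclideanSpace.single k (K.lo k + K.hi k - 2 * A k) with hb
        have hbk : b k = K.lo k + K.hi k - A k := by simp [hb]; ring
        have hbl : ∀ l, l ≠ k → b l = A l := fun l hl => by simp [hb, hl]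
        have hbv : b ∈ K.vertices := by
          intro l
          by_cases hl : l = k
          · subst hl
            rw [hbk]
            rcases hA l with h | h <;> rw [h]
            · right; ring
            · left; ring
          · rw [hbl l hl]; exact hA l
        have hedge : K.IsEdge A b := by
          refine ⟨hA, hbv, k, ?_, fun l hl => (hbl l hl).symm⟩
          rw [hbk]
          have := K.lo_lt_hi k
          rcases hA k with h | h <;> rw [h] <;> intro h' <;> linarith
        set m := L (EuclideanSpace.single k (K.lo k + K.hi k - 2 * A k)) with hm
        have hLb : L b - c = D + m := by rw [hb, map_add, hDdef]; ring
        have hvol := hlarge A b hedge ⟨A, left_mem_segment ℝ A b, hAU⟩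
        by_contra hlt
        rw [not_le] at hlt
        have hm0 : m < 0 := by
          by_contra h
          have := mul_nonneg hδ₀.le (not_lt.1 h)
          linarith
        have hτ : (D + d) / (-m) < δ₀ := by rw [div_lt_iff₀ (by linarith)]; linarith
        have hsub : {t : ℝ | t ∈ Icc (0 : ℝ) 1 ∧ AffineMap.lineMap A b t ∈ U} ⊆
            Icc 0 ((D + d) / (-m)) := by
          rintro t ⟨ht, htU⟩
          refine ⟨ht.1, ?_⟩
          rw [le_div_iff₀ (by linarith)]
          by_contra hgt
          rw [not_le] at hgt
          have hcl : AffineMap.lineMap A b t ∈ closure K.carrier := by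
            rw [K.closure_carrier]
            intro l
            have h1 := hAc l
            have h2 := K.vertices_subset_closed hbv l
            simp only [AffineMap.lineMap_apply_module, PiLp.add_apply, PiLp.smul_apply, smul_eq_mul]
            constructor <;> nlinarith [ht.1, ht.2]
          obtain ⟨y, ⟨hyU, hyd⟩, hyK⟩ := mem_closure_iff.1 hcl (U ∩ {x | L x - c < -d})
            (hU.inter (hopen' (-d))) ⟨htU, by
              show L (AffineMap.lineMap A b t) - c < -d
              rw [AffineMap.lineMap_apply, vsub_eq_sub, vadd_eq_add, add_comm, hLh, hLb]
              linarith⟩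
          exact disjoint_left.1 hHU ⟨hyK, hyd⟩ hyU
        have := hvol.trans (measure_mono hsub)
        rw [Real.volume_Icc, sub_zero, ENNReal.ofReal_le_ofReal_iff'] at this
        rcases this with h | h <;> linarith
      have himg : AffineMap.homothety A (δ₀ / 3) '' K.carrier ⊆ E := by
        rintro _ ⟨y, hy, rfl⟩
        have e : AffineMap.homothety A (δ₀ / 3) y = A + (δ₀ / 3) • (y - A) := by
          rw [AffineMap.homothety_apply, vsub_eq_sub, vadd_eq_add, add_comm]
        rw [e]
        refine ⟨K.homothety_mem_carrier hAc hy (by positivity) (by linarith), ?_⟩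
        -- `y - A` is a combination of the edge vectors with coefficients `r k` in `(0, 1)`
        have hr : ∀ k, ∃ r : ℝ, 0 < r ∧ r < 1 ∧ y k - A k = r * (K.lo k + K.hi k - 2 * A k) := by
          intro k
          have hk := K.lo_lt_hi k
          have h1 := hy k
          rcases hA k with h | h <;> rw [h]
          · refine ⟨(y k - K.lo k) / (K.hi k - K.lo k), div_pos (by linarith) (by linarith),
              by rw [div_lt_one (by linarith)]; linarith, ?_⟩
            have : K.hi k - K.lo k ≠ 0 := by linarith
            field_simp; ring
          · refine ⟨(K.hi k - y k) / (K.hi k - K.lo k), div_pos (by linarith) (by linarith),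
              by rw [div_lt_one (by linarith)]; linarith, ?_⟩
            have : K.hi k - K.lo k ≠ 0 := by linarith
            field_simp; ring
        choose r hr0 hr1 hr using hr
        have hyA : y - A = ∑ k, r k • (EuclideanSpace.single k (K.lo k + K.hi k - 2 * A k) : E3) := by
          ext l
          simp only [PiLp.sub_apply, hr, Fin.sum_univ_three]
          fin_cases l <;> simp
        rw [map_add, map_smul, hyA, map_sum, Fin.sum_univ_three]
        simp only [map_smul, smul_eq_mul]
        have h0 := hcorner 0
        have h1 := hcorner 1
        have h2 := hcorner 2
        set m0 := L (EuclideanSpace.single 0 (K.lo 0 + K.hi 0 - 2 * A 0))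
        set m1 := L (EuclideanSpace.single 1 (K.lo 1 + K.hi 1 - 2 * A 1))
        set m2 := L (EuclideanSpace.single 2 (K.lo 2 + K.hi 2 - 2 * A 2))
        have k0 := mul_nonneg (hr0 0).le (sub_nonneg.2 h0)
        have k1 := mul_nonneg (hr0 1).le (sub_nonneg.2 h1)
        have k2 := mul_nonneg (hr0 2).le (sub_nonneg.2 h2)
        have k3 : 0 < (D + d) * (3 - r 0 - r 1 - r 2) :=
          mul_pos (by linarith) (by linarith [hr1 0, hr1 1, hr1 2])
        have : L A = D + c := by rw [hDdef]; ring
        rw [this]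
        nlinarith
      refine le_trans (le_of_eq ?_) (measure_mono himg)
      rw [Measure.addHaar_image_homothety, abs_of_pos (by positivity)]
      simp
    · intro n W hWc hW0 hWp
      refine (hEW n W hWc hW0 hWp).trans ?_
      gcongr
      have : 0 ≤ growth ((1 + 3 * η) / (1 - η)) ^ (n + 3) := pow_nonneg (by linarith) _
      linarith

/-! ### Area bounds for the boundaries of the pieces -/

/-- The area of the part of `S` in a ball of radius `r` is at most a constant times `r²`. -/
def IsUpperRegular (S : Set E3) : Prop :=
  ∃ c : ℝ≥0∞, c ≠ ∞ ∧ ∀ z r, 0 < r →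
    (Measure.euclideanHausdorffMeasure 2 : Measure E3) (S ∩ Metric.closedBall z r) ≤
      c * ENNReal.ofReal (r ^ 2)

lemma IsUpperRegular.mono {S S' : Set E3} (h : IsUpperRegular S') (hS : S ⊆ S') :
    IsUpperRegular S := by
  obtain ⟨c, hc, h⟩ := h
  exact ⟨c, hc, fun z r hr => (measure_mono (inter_subset_inter_left _ hS)).trans (h z r hr)⟩

lemma IsUpperRegular.union {S S' : Set E3} (h : IsUpperRegular S) (h' : IsUpperRegular S') :
    IsUpperRegular (S ∪ S') := by
  obtain ⟨c, hc, h⟩ := h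
  obtain ⟨c', hc', h'⟩ := h'
  refine ⟨c + c', ENNReal.add_ne_top.2 ⟨hc, hc'⟩, fun z r hr => ?_⟩
  rw [union_inter_distrib_right, add_mul]
  exact (measure_union_le _ _).trans (add_le_add (h z r hr) (h' z r hr))

/-- Graphs of Lipschitz functions are upper regular. -/
lemma isUpperRegular_graph (L : E3 ≃ₗᵢ[ℝ] E3) {ψ : EuclideanSpace ℝ (Fin 2) → ℝ} {Λ : ℝ≥0}
    {V : Set (EuclideanSpace ℝ (Fin 2))} (hψ : LipschitzOnWith Λ ψ V) {S : Set E3}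
    (hS : ∀ y ∈ S, !₂[(L y) 0, (L y) 1] ∈ V ∧ (L y) 2 = ψ !₂[(L y) 0, (L y) 1]) :
    IsUpperRegular S := by
  set Φ : EuclideanSpace ℝ (Fin 2) → E3 := fun w => L.symm !₂[w 0, w 1, ψ w] with hΦ
  have hlip : LipschitzOnWith (1 + Λ) Φ V := by
    refine LipschitzOnWith.of_dist_le_mul fun w hw w' hw' => ?_
    have h1 := hψ.dist_le_mul w hw w' hw'
    rw [Real.dist_eq] at h1
    simp only [hΦ]
    rw [L.symm.dist_map, EuclideanSpace.dist_eq]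
    have h2 : dist w w' ^ 2 = (w 0 - w' 0) ^ 2 + (w 1 - w' 1) ^ 2 := by
      rw [EuclideanSpace.dist_eq, Real.sq_sqrt (by positivity), Fin.sum_univ_two, Real.dist_eq,
        Real.dist_eq, sq_abs, sq_abs]
    refine Real.sqrt_le_iff.2 ⟨by positivity, ?_⟩
    have h3 : |ψ w - ψ w'| ^ 2 ≤ (Λ * dist w w') ^ 2 := pow_le_pow_left₀ (abs_nonneg _) h1 2
    rw [sq_abs] at h3
    simp only [Fin.sum_univ_three, Real.dist_eq, sq_abs]
    simp only [Matrix.cons_val_zero, Matrix.cons_val_one, Matrix.cons_val]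
    rw [← h2]
    push_cast
    nlinarith [mul_nonneg Λ.coe_nonneg (sq_nonneg (dist w w'))]
  refine ⟨((1 + Λ : ℝ≥0) : ℝ≥0∞) ^ (2 : ℝ) * NNReal.pi, by finiteness, fun z r hr => ?_⟩
  set B := Metric.closedBall (!₂[(L z) 0, (L z) 1] : EuclideanSpace ℝ (Fin 2)) r with hB
  have hsub : S ∩ Metric.closedBall z r ⊆ Φ '' (V ∩ B) := by
    rintro y ⟨hyS, hyz⟩
    obtain ⟨h1, h2⟩ := hS y hyS
    refine ⟨_, ⟨h1, ?_⟩, ?_⟩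
    · rw [hB, Metric.mem_closedBall]
      rw [Metric.mem_closedBall, ← L.dist_map, EuclideanSpace.dist_eq] at hyz
      refine le_trans ?_ hyz
      rw [EuclideanSpace.dist_eq]
      refine Real.sqrt_le_sqrt ?_
      simp only [Fin.sum_univ_three, Fin.sum_univ_two]
      simp only [Matrix.cons_val_zero, Matrix.cons_val_one]
      linarith [sq_nonneg (dist ((L y) 2) ((L z) 2))]
    · simp only [hΦ]
      rw [LinearIsometryEquiv.symm_apply_eq]
      ext k
      fin_cases k
      · simp
      · simp
      · simpa using h2.symm
  have hmeas : (Measure.euclideanHausdorffMeasure 2 : Measure E3) (Φ '' (V ∩ B)) ≤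
      ((1 + Λ : ℝ≥0) : ℝ≥0∞) ^ (2 : ℝ) *
        (Measure.euclideanHausdorffMeasure 2 : Measure (EuclideanSpace ℝ (Fin 2))) (V ∩ B) := by
    have := (hlip.mono (inter_subset_left (t := B))).hausdorffMeasure_image_le (d := 2) zero_le_two
    rw [Measure.euclideanHausdorffMeasure_def, Measure.euclideanHausdorffMeasure_def,
      Measure.smul_apply, Measure.smul_apply, ENNReal.smul_def, ENNReal.smul_def, smul_eq_mul,
      smul_eq_mul, mul_left_comm]
    gcongr
    exact_mod_cast this
  refine (measure_mono hsub).trans (hmeas.trans ?_)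
  rw [EuclideanSpace.euclideanHausdorffMeasure_eq_volume, mul_assoc]
  gcongr
  refine (measure_mono inter_subset_right).trans (le_of_eq ?_)
  rw [hB, EuclideanSpace.volume_closedBall_fin_two, ENNReal.ofReal_pow hr.le, mul_comm]
  rw [← NNReal.coe_real_pi, ENNReal.ofReal_coe_nnreal]

lemma isUpperRegular_coordinatePlane (k : Fin 3) (c : ℝ) : IsUpperRegular {x : E3 | x k = c} := by
  refine isUpperRegular_graph (LinearIsometryEquiv.piLpCongrLeft 2 ℝ ℝ (Equiv.swap k 2))
    (ψ := fun _ => c) (Λ := 0) (V := univ) (LipschitzWith.const c).lipschitzOnWith fun y hy =>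
    ⟨mem_univ _, ?_⟩
  simpa [LinearIsometryEquiv.piLpCongrLeft_apply] using hy

/-- The boundary is compact, and locally contained in the graph of a Lipschitz function. -/
lemma HasGraphBoundary.isUpperRegular {reg : (EuclideanSpace ℝ (Fin 2) → ℝ) → Prop} {U : Set E3}
    (h : HasGraphBoundary reg U) (hreg : ∀ ψ, reg ψ → LocallyLipschitz ψ)
    (hb : Bornology.IsBounded U) : IsUpperRegular (frontier U) := by
  have hc : IsCompact (frontier U) :=
    hb.isCompact_closure.of_isClosed_subset isClosed_frontier frontier_subset_closure
  refine hc.induction_on (p := IsUpperRegular) ⟨0, by simp, by simp⟩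
    (fun s t hst ht => ht.mono hst) (fun s t hs ht => hs.union ht) fun x hx => ?_
  obtain ⟨r, hr, L, ψ, hψ, hy⟩ := h x hx
  obtain ⟨Λ, V, hV, hlip⟩ := hreg ψ hψ !₂[(L x) 0, (L x) 1]
  have hcont : Continuous fun y : E3 => (!₂[(L y) 0, (L y) 1] : EuclideanSpace ℝ (Fin 2)) := by
    refine (PiLp.continuous_toLp 2 _).comp (continuous_pi fun i => ?_)
    fin_cases i
    · simp; fun_prop
    · simp; fun_prop
  refine ⟨frontier U ∩ (Metric.ball x r ∩ (fun y : E3 => !₂[(L y) 0, (L y) 1]) ⁻¹' V),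
    inter_mem_nhdsWithin _ (Filter.inter_mem (Metric.ball_mem_nhds x hr)
      (hcont.continuousAt.preimage_mem_nhds hV)),
    isUpperRegular_graph L hlip fun y hy' => ⟨hy'.2.2, ((hy y hy'.2.1).2).1 hy'.1⟩⟩

/-- Each boundary point of a set below a graph is a limit of exterior points. -/
lemma HasGraphBoundary.mem_closure_compl {reg : (EuclideanSpace ℝ (Fin 2) → ℝ) → Prop} {U : Set E3}
    (h : HasGraphBoundary reg U) {x : E3} (hx : x ∈ frontier U) : x ∈ closure (closure U)ᶜ := by
  obtain ⟨r, hr, L, ψ, -, hy⟩ := h x hx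
  set e : E3 := L.symm (EuclideanSpace.single 2 1) with he
  have hc : Continuous fun t : ℝ => x + t • e := by fun_prop
  have hlim : Filter.Tendsto (fun t : ℝ => x + t • e) (nhdsWithin 0 (Ioi 0)) (nhds x) := by
    have := (hc.tendsto 0).mono_left (nhdsWithin_le_nhds (s := Ioi (0 : ℝ)))
    simpa using this
  refine mem_closure_of_tendsto hlim ?_
  filter_upwards [hlim (Metric.ball_mem_nhds x hr), self_mem_nhdsWithin] with t ht ht0
  have hLt : L (x + t • e) = L x + t • EuclideanSpace.single 2 1 := by
    rw [map_add, map_smul, he, LinearIsometryEquiv.apply_symm_apply]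
  have hx2 := ((hy x (Metric.mem_ball_self hr)).2).1 hx
  have hyt := hy _ ht
  rw [hLt] at hyt
  simp only [PiLp.add_apply, PiLp.smul_apply, PiLp.single_apply, smul_eq_mul,
    show (0 : Fin 3) ≠ 2 by decide, show (1 : Fin 3) ≠ 2 by decide, if_true, if_false, mul_one,
    mul_zero, add_zero] at hyt
  rw [← hx2] at hyt
  rw [mem_Ioi] at ht0
  intro hcl
  by_cases hU : x + t • e ∈ interior U
  · have := hyt.1.1 (interior_subset hU)
    linarith
  · have := hyt.2.1 ⟨hcl, hU⟩
    linarith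

lemma frontier_carrier_inter_subset (K : Hexahedron) (U : Set E3) :
    frontier (K.carrier ∩ U) ⊆
      (⋃ k, ({x : E3 | x k = K.lo k} ∪ {x : E3 | x k = K.hi k})) ∪ frontier U := by
  refine (frontier_inter_subset _ _).trans (union_subset_union ?_ inter_subset_right)
  rintro x ⟨hx, -⟩
  rw [K.isOpen_carrier.frontier_eq, K.closure_carrier] at hx
  obtain ⟨hx, hx'⟩ := hx
  by_contra hne
  simp only [mem_iUnion, mem_union, mem_ofPred_eq, not_exists, not_or] at hne
  exact hx' fun k => ⟨lt_of_le_of_ne (hx k).1 (Ne.symm (hne k).1), lt_of_le_of_ne (hx k).2 (hne k).2⟩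

lemma isOpen_subdomain {Ω Ω₁ : Set E3} (hΩ : IsInterfaceGeometry Ω Ω₁) (i : Fin 2) :
    IsOpen (subdomain Ω Ω₁ i) := by
  fin_cases i
  · exact hΩ.isOpen_one
  · exact hΩ.isOpen.sdiff isClosed_closure

lemma frontier_subdomain_subset (Ω Ω₁ : Set E3) (i : Fin 2) :
    frontier (subdomain Ω Ω₁ i) ⊆ frontier Ω₁ ∪ frontier Ω := by
  fin_cases i
  · exact subset_union_left
  · show frontier (Ω \ closure Ω₁) ⊆ _
    rw [sdiff_eq]
    refine (frontier_inter_subset _ _).trans (union_subset ?_ ?_)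
    · exact inter_subset_left.trans subset_union_right
    · refine inter_subset_right.trans (subset_trans ?_ subset_union_left)
      rw [frontier_compl]
      exact frontier_closure_subset

/-- The boundaries of the pieces `K ∩ Ω₁`, `K ∩ Ω₂` are upper regular, uniformly in `K`. -/
lemma exists_upperRegular_bound {Ω Ω₁ : Set E3} (hΩ : IsInterfaceGeometry Ω Ω₁) :
    ∃ c : ℝ≥0∞, c ≠ ∞ ∧ ∀ (K : Hexahedron) (i : Fin 2) (z : E3) (r : ℝ), 0 < r →
      (Measure.euclideanHausdorffMeasure 2 : Measure E3)
        (frontier (K.carrier ∩ subdomain Ω Ω₁ i) ∩ Metric.closedBall z r) ≤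
        c * ENNReal.ofReal (r ^ 2) := by
  have hS : IsUpperRegular (frontier Ω₁ ∪ frontier Ω) :=
    (hΩ.smooth_interface.isUpperRegular
      (fun ψ hψ => (hψ.of_le one_le_two).locallyLipschitz)
      (hΩ.isBounded.subset (subset_closure.trans hΩ.closure_subset))).union
    (hΩ.lipschitz_boundary.isUpperRegular (fun ψ ⟨L, hL⟩ => hL.locallyLipschitz) hΩ.isBounded)
  -- the constant of a coordinate plane does not depend on its position
  have hP : ∃ c : ℝ≥0∞, c ≠ ∞ ∧ ∀ (k : Fin 3) (b : ℝ) (z : E3) (r : ℝ), 0 < r →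
      (Measure.euclideanHausdorffMeasure 2 : Measure E3)
        ({x : E3 | x k = b} ∩ Metric.closedBall z r) ≤ c * ENNReal.ofReal (r ^ 2) := by
    choose c hc h using fun k => isUpperRegular_coordinatePlane k 0
    refine ⟨∑ k, c k, ENNReal.sum_ne_top.2 fun k _ => hc k, fun k b z r hr => ?_⟩
    have e : {x : E3 | x k = b} ∩ Metric.closedBall z r ⊆
        IsometryEquiv.addRight (EuclideanSpace.single k b : E3) ''
          ({x : E3 | x k = 0} ∩ Metric.closedBall (z - EuclideanSpace.single k b) r) := by
      rintro x ⟨hx, hxz⟩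
      refine ⟨x - EuclideanSpace.single k b, ⟨?_, ?_⟩, by simp⟩
      · simpa [sub_eq_zero] using hx
      · simpa using hxz
    refine (measure_mono e).trans ?_
    rw [(IsometryEquiv.isometry _).euclideanHausdorffMeasure_image]
    refine (h k _ r hr).trans ?_
    gcongr
    exact Finset.single_le_sum (f := c) (fun _ _ => zero_le) (Finset.mem_univ k)
  obtain ⟨c, hc, hS⟩ := hS
  obtain ⟨c', hc', hP⟩ := hP
  refine ⟨∑ _k : Fin 3, (c' + c') + c, ENNReal.add_ne_top.2 ⟨ENNReal.sum_ne_top.2 fun _ _ =>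
    ENNReal.add_ne_top.2 ⟨hc', hc'⟩, hc⟩, fun K i z r hr => ?_⟩
  have hsub := (frontier_carrier_inter_subset K (subdomain Ω Ω₁ i)).trans
    (union_subset_union_right _ (frontier_subdomain_subset Ω Ω₁ i))
  refine (measure_mono (inter_subset_inter_left _ hsub)).trans ?_
  rw [union_inter_distrib_right, iUnion_inter, add_mul, Finset.sum_mul]
  refine (measure_union_le _ _).trans (add_le_add ?_ (hS z r hr))
  refine (measure_iUnion_fintype_le _ _).trans (Finset.sum_le_sum fun k _ => ?_)
  rw [union_inter_distrib_right, add_mul]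
  exact (measure_union_le _ _).trans (add_le_add (hP k _ z r hr) (hP k _ z r hr))

/-! ### Planes of triangles -/

/-- The distance to the plane of a triangle is the absolute value of an affine function. -/
lemma exists_infEDist_planeOf (f : Affine.Triangle ℝ E3) :
    ∃ (L : E3 →L[ℝ] ℝ) (c : ℝ), (∃ a, L a ≠ c) ∧
      ∀ x, Metric.infEDist x (planeOf f) = ENNReal.ofReal |L x - c| := by
  set s : AffineSubspace ℝ E3 := affineSpan ℝ (range f.points) with hs
  set q : E3 := f.points 0 with hq
  have hqs : q ∈ s := mem_affineSpan ℝ (mem_range_self 0)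
  have : Nonempty s := ⟨⟨q, hqs⟩⟩
  have hdim : Module.finrank ℝ s.direction = 2 := by
    rw [hs, direction_affineSpan]
    exact f.independent.finrank_vectorSpan (by simp)
  have hdim' : Module.finrank ℝ s.directionᗮ = 1 := by
    have := s.direction.finrank_add_finrank_orthogonal
    rw [hdim] at this
    have h3 : Module.finrank ℝ E3 = 3 := by simp
    omega
  obtain ⟨w, hw0, hw⟩ := finrank_eq_one_iff'.1 hdim'
  set u : E3 := (w : E3) with hu
  have hu0 : u ≠ 0 := fun h => hw0 (by ext1; exact h)
  set n : E3 := ‖u‖⁻¹ • u with hn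
  have hn1 : ‖n‖ = 1 := by
    rw [hn, norm_smul, norm_inv, norm_norm, inv_mul_cancel₀ (norm_ne_zero_iff.2 hu0)]
  have hnperp : n ∈ s.directionᗮ := Submodule.smul_mem _ _ w.2
  refine ⟨innerSL ℝ n, inner ℝ n q, ⟨q + n, ?_⟩, fun x => ?_⟩
  · rw [innerSL_apply_apply, inner_add_right, real_inner_self_eq_norm_sq, hn1]
    intro h
    norm_num at h
  · set y : E3 := (EuclideanGeometry.orthogonalProjection s x : E3) with hy
    have hperp : x - y ∈ s.directionᗮ :=
      EuclideanGeometry.vsub_orthogonalProjection_mem_direction_orthogonal s x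
    obtain ⟨r, hr⟩ := hw ⟨x - y, hperp⟩
    have hr' : x - y = (r * ‖u‖) • n := by
      have : r • u = x - y := congrArg Subtype.val hr
      rw [← this, hn, smul_smul, mul_assoc, mul_inv_cancel₀ (norm_ne_zero_iff.2 hu0), mul_one]
    have hyq : inner ℝ n (y - q) = 0 :=
      s.direction.inner_left_of_mem_orthogonal (AffineSubspace.vsub_mem_direction
        (EuclideanGeometry.orthogonalProjection_mem x) hqs) hnperp
    have hval : innerSL ℝ n x - inner ℝ n q = r * ‖u‖ := by
      rw [innerSL_apply_apply, ← inner_sub_right, show x - q = (x - y) + (y - q) by abel,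
        inner_add_right, hyq, add_zero, hr', real_inner_smul_right, real_inner_self_eq_norm_sq, hn1]
      ring
    have hdist : dist x y = |r * ‖u‖| := by
      rw [dist_eq_norm, hr', norm_smul, hn1, mul_one, Real.norm_eq_abs]
    rw [hval, ← hdist, hy, EuclideanGeometry.dist_orthogonalProjection_eq_infDist, Metric.infDist,
      ENNReal.ofReal_toReal (Metric.infEDist_ne_top ⟨q, hqs⟩)]
    rfl

/-- If the boundary of `U` inside `K` is contained in a plane, then a vertex of `K` that is in `U`
is not on this plane. -/
lemma ne_of_frontier_subset_plane {K : Hexahedron} {U : Set E3} (hU : IsOpen U) {A x : E3}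
    (hA : A ∈ K.closed) (hAU : A ∈ U) (hxK : x ∈ K.carrier) (hx : x ∈ frontier U)
    (hx' : x ∈ closure (closure U)ᶜ) {L : E3 →L[ℝ] ℝ} {c : ℝ} (hL : ∃ a, L a ≠ c)
    (hfr : ∀ y ∈ K.carrier, y ∈ frontier U → L y = c) : L A ≠ c := by
  intro hAc
  obtain ⟨a, ha⟩ := hL
  have hz : volume {y : E3 | L y = c} = 0 := volume_level_eq_zero L ha
  -- an open set near `x` has points on one of the sides of the plane
  have hside : ∀ V : Set E3, IsOpen V → x ∈ closure V → ∃ y ∈ K.carrier ∩ V, L y ≠ c := by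
    intro V hV hxV
    have hne : (K.carrier ∩ V).Nonempty := mem_closure_iff.1 hxV _ K.isOpen_carrier hxK
    by_contra! hall
    exact ((K.isOpen_carrier.inter hV).measure_pos volume hne).ne'
      (measure_mono_null hall hz)
  set G : Set E3 := {y | y ∈ K.carrier ∧ c < L y}
  set H : Set E3 := {y | y ∈ K.carrier ∧ L y < c}
  have hG : G ⊆ U ∨ Disjoint G U := Convex.subset_or_disjoint_of_frontier
    (K.convex_carrier.inter (convex_halfSpace_gt L.isLinear c)) hU
    fun y hy hyf => (hfr y hy.1 hyf).not_gt hy.2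
  have hH : H ⊆ U ∨ Disjoint H U := Convex.subset_or_disjoint_of_frontier
    (K.convex_carrier.inter (convex_halfSpace_lt L.isLinear c)) hU
    fun y hy hyf => (hfr y hy.1 hyf).not_lt hy.2
  have hmem : ∀ y ∈ K.carrier, L y ≠ c → y ∈ G ∨ y ∈ H := fun y hy hne => by
    rcases lt_or_gt_of_ne hne with h | h
    · exact Or.inr ⟨hy, h⟩
    · exact Or.inl ⟨hy, h⟩
  obtain ⟨y, ⟨hyK, hyU⟩, hyc⟩ := hside U hU (frontier_subset_closure hx)
  obtain ⟨z, ⟨hzK, hzU⟩, hzc⟩ := hside _ isClosed_closure.isOpen_compl hx'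
  have hzU' : z ∉ U := fun h => hzU (subset_closure h)
  -- points of the plane in `K` are limits of points of both sides
  have hlim : ∀ w ∈ K.carrier, L w = c → ∀ b ∈ K.carrier, L b ≠ c →
      ∀ O : Set E3, IsOpen O → w ∈ O → ∃ e ∈ K.carrier ∩ O,
        (c < L b → c < L e) ∧ (L b < c → L e < c) := by
    intro w hw hwc b hb hbc O hO hwO
    have hcont : Continuous fun t : ℝ => w + t • (b - w) := by fun_prop
    have hnh : (fun t : ℝ => w + t • (b - w)) ⁻¹' O ∈ nhdsWithin (0 : ℝ) (Ioi 0) :=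
      nhdsWithin_le_nhds (hcont.continuousAt.preimage_mem_nhds (hO.mem_nhds (by simpa using hwO)))
    obtain ⟨t, ht, ht0⟩ := Filter.nonempty_of_mem
      (Filter.inter_mem hnh (Ioc_mem_nhdsGT (zero_lt_one' ℝ)))
    refine ⟨_, ⟨K.homothety_mem_carrier (K.carrier_subset_closed hw) hb ht0.1 ht0.2, ht⟩, ?_, ?_⟩
    all_goals
      intro h
      rw [map_add, map_smul, map_sub, hwc, smul_eq_mul]
    · nlinarith [mul_pos ht0.1 (sub_pos.2 h)]
    · nlinarith [mul_pos ht0.1 (sub_pos.2 h)]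
  have hplane : ∀ w ∈ K.carrier, L w = c → w ∈ frontier U := by
    intro w hw hwc
    have key : ∀ b ∈ K.carrier, L b ≠ c → ∀ O : Set E3, IsOpen O → w ∈ O →
        ∃ e ∈ K.carrier ∩ O, (b ∈ U ↔ e ∈ U) := by
      intro b hb hbc O hO hwO
      obtain ⟨e, he, h1, h2⟩ := hlim w hw hwc b hb hbc O hO hwO
      refine ⟨e, he, ?_⟩
      rcases hmem b hb hbc with hbG | hbH
      · have heG : e ∈ G := ⟨he.1, h1 hbG.2⟩
        rcases hG with h | h
        · exact ⟨fun _ => h heG, fun _ => h hbG⟩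
        · exact ⟨fun h' => (disjoint_left.1 h hbG h').elim, fun h' => (disjoint_left.1 h heG h').elim⟩
      · have heH : e ∈ H := ⟨he.1, h2 hbH.2⟩
        rcases hH with h | h
        · exact ⟨fun _ => h heH, fun _ => h hbH⟩
        · exact ⟨fun h' => (disjoint_left.1 h hbH h').elim, fun h' => (disjoint_left.1 h heH h').elim⟩
    rw [hU.frontier_eq]
    refine ⟨mem_closure_iff.2 fun O hO hwO => ?_, fun hwU => ?_⟩
    · obtain ⟨e, he, heU⟩ := key y hyK hyc O hO hwO
      exact ⟨e, he.2, heU.1 hyU⟩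
    · obtain ⟨e, he, heU⟩ := key z hzK hzc U hU hwU
      exact hzU' (heU.2 he.2)
  -- the plane connects `x` with `A` inside `K`
  have hA' : A ∈ closure (frontier U) := by
    have hcont : Continuous fun t : ℝ => A + t • (x - A) := by fun_prop
    have htend : Filter.Tendsto (fun t : ℝ => A + t • (x - A)) (nhdsWithin 0 (Ioi 0)) (nhds A) := by
      have := (hcont.tendsto 0).mono_left (nhdsWithin_le_nhds (s := Ioi (0 : ℝ)))
      simpa using this
    refine mem_closure_of_tendsto htend ?_
    filter_upwards [Ioc_mem_nhdsGT (zero_lt_one' ℝ)] with t ht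
    refine hplane _ (K.homothety_mem_carrier hA hxK ht.1 ht.2) ?_
    rw [map_add, map_smul, map_sub, hAc, hfr x hxK hx, sub_self, smul_zero, add_zero]
  rw [isClosed_frontier.closure_eq, hU.frontier_eq] at hA'
  exact hA'.2 hAU

/-! ### The inverse trace estimate for one element -/

/-- The constant of the inverse trace estimate for elements with aspect ratio `κ`, fraction `δ₀` of
the edges and area bound `c`. -/
def traceConst (κ δ₀ c : ℝ) : ℝ :=
  √(2 * (64 * Real.exp 3 * 19 ^ 2) * c * growth 5 ^ 3 / (δ₀ / 3 * κ) ^ 3)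

lemma eLpNorm_two_eq_lintegral {𝕜 : Type*} [RCLike 𝕜] (f : E3 → 𝕜) (μ : Measure E3) :
    eLpNorm f 2 μ = (∫⁻ x, ENNReal.ofReal (‖f x‖ ^ 2) ∂μ) ^ (1 / 2 : ℝ) := by
  rw [eLpNorm_eq_lintegral_rpow_enorm_toReal two_ne_zero ENNReal.ofNat_ne_top]
  simp only [ENNReal.toReal_ofNat]
  congr 2
  ext x
  rw [ENNReal.ofReal_pow (norm_nonneg _), ofReal_norm]
  exact ENNReal.rpow_two _

/-- Growth and trace combined: `E` is a convex superset of `K ∩ U`, as obtained from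
`exists_convex_superset`. The degree of the square of the modulus is `6p`, hence the exponent `3p`
after the square root; the additional factor `growth ^ 3` is bounded since `η ≤ 1 / 2`. -/
lemma boundaryNormL2_le {𝕜 : Type*} [RCLike 𝕜] {K : Hexahedron} {U E : Set E3} {κ δ₀ η : ℝ}
    (hκ : 0 < κ) (hδ₀ : 0 < δ₀) (hη0 : 0 ≤ η) (hη : η ≤ 1 / 2)
    (hK : ∀ k, κ * K.size ≤ K.hi k - K.lo k) (hEo : IsOpen E) (hEc : Convex ℝ E)
    (hEK : E ⊆ K.carrier) (hUE : K.carrier ∩ U ⊆ E)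
    (hvol : ENNReal.ofReal ((δ₀ / 3) ^ 3) * volume K.carrier ≤ volume E)
    (hE : ∀ (n : ℕ) (W : E3 → ℝ), Continuous W → (∀ x, 0 ≤ W x) → IsPolyOnLines n W →
        ∫⁻ x in E, ENNReal.ofReal (W x) ≤
          ENNReal.ofReal (2 * growth ((1 + 3 * η) / (1 - η)) ^ (n + 3)) *
            ∫⁻ x in K.carrier ∩ U, ENNReal.ofReal (W x))
    {c : ℝ≥0∞} (hc : c ≠ ∞)
    (hreg : ∀ (z : E3) (r : ℝ), 0 < r → (Measure.euclideanHausdorffMeasure 2 : Measure E3)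
        (frontier (K.carrier ∩ U) ∩ Metric.closedBall z r) ≤ c * ENNReal.ofReal (r ^ 2))
    {p : ℕ} (hp : 1 ≤ p) {v : MvPolynomial (Fin 3) 𝕜} (hv : IsQ p v) :
    boundaryNormL2 (K.carrier ∩ U) (polyFun v) ≤
      ENNReal.ofReal (traceConst κ δ₀ c.toReal * p * K.size ^ (-(1 / 2) : ℝ) *
        growth ((1 + 3 * η) / (1 - η)) ^ (3 * p)) * normL2 (K.carrier ∩ U) (polyFun v) := by
  have hh := K.size_pos
  set h := K.size with hhd
  set g := growth ((1 + 3 * η) / (1 - η)) with hg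
  have hlam : 1 ≤ (1 + 3 * η) / (1 - η) := by rw [le_div_iff₀ (by linarith)]; linarith
  have hg1 : 1 ≤ g := one_le_growth hlam
  have hg5 : g ≤ growth 5 := growth_le_growth hlam (by rw [div_le_iff₀ (by linarith)]; linarith)
  set W : E3 → ℝ := fun x => ‖polyFun v x‖ ^ 2 with hW
  have hWc : Continuous W := (continuous_polyFun v).norm.pow 2
  have hW0 : ∀ x, 0 ≤ W x := fun x => sq_nonneg _
  have hWp : IsPolyOnLines (6 * p) W := isPolyOnLines_normSq_polyFun hv
  set S := frontier (K.carrier ∩ U) with hS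
  set μ : Measure E3 := (Measure.euclideanHausdorffMeasure 2 : Measure E3).restrict S with hμ
  have hSE : S ⊆ closure E := frontier_subset_closure.trans (closure_mono hUE)
  have htr := volume_mul_lintegral_closure_le hWc hW0 hWp hEo hEc hh
    (fun x hx y hy => K.dist_le_size (K.carrier_subset_closed (hEK hy))
      (by rw [← K.closure_carrier]; exact closure_mono hEK hx)) (μ := μ) hc (fun z r hr => by
      rw [hμ, Measure.restrict_apply Metric.isClosed_closedBall.measurableSet, inter_comm]
      exact hreg z r hr)
  rw [hμ, Measure.restrict_restrict isClosed_closure.measurableSet,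
    inter_eq_self_of_subset_right hSE] at htr
  set B := ∫⁻ x in S, ENNReal.ofReal (W x) ∂(Measure.euclideanHausdorffMeasure 2 : Measure E3)
    with hB
  set I := ∫⁻ x in K.carrier ∩ U, ENNReal.ofReal (W x) with hI
  -- the volume of `E` is comparable to `h ^ 3`
  set b := (δ₀ / 3 * κ) ^ 3 * h ^ 3 with hb
  have hb0 : 0 < b := by positivity
  have hbE : ENNReal.ofReal b ≤ volume E := by
    refine le_trans ?_ hvol
    rw [show b = (δ₀ / 3) ^ 3 * (κ * h) ^ 3 by rw [hb]; ring, ENNReal.ofReal_mul (by positivity)]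
    gcongr
    exact K.le_volume_carrier (by positivity) hK
  have hcR : c = ENNReal.ofReal c.toReal := (ENNReal.ofReal_toReal hc).symm
  have hc0 : 0 ≤ c.toReal := ENNReal.toReal_nonneg
  set M := 64 * Real.exp 3 * ((3 * (6 * p) + 1 : ℕ) : ℝ) ^ 2 * h ^ 2 with hM
  have hM0 : 0 ≤ M := by positivity
  have hBI : ENNReal.ofReal b * B ≤
      ENNReal.ofReal (M * c.toReal * (2 * g ^ (6 * p + 3))) * I := by
    calc ENNReal.ofReal b * B ≤ volume E * B := by gcongr
      _ ≤ ENNReal.ofReal M * c * ∫⁻ x in E, ENNReal.ofReal (W x) := htr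
      _ ≤ ENNReal.ofReal M * c * (ENNReal.ofReal (2 * g ^ (6 * p + 3)) * I) := by
          gcongr
          exact hE _ W hWc hW0 hWp
      _ = _ := by
          rw [ENNReal.ofReal_mul (p := M * c.toReal) (by positivity),
            ENNReal.ofReal_mul (p := M) hM0, ← hcR, mul_assoc, mul_assoc, mul_assoc]
  set Q := traceConst κ δ₀ c.toReal * p * h ^ (-(1 / 2) : ℝ) * g ^ (3 * p) with hQ
  have hQ0 : 0 ≤ Q := by unfold Q traceConst; positivity
  have hQ2 : Q ^ 2 = 2 * (64 * Real.exp 3 * 19 ^ 2) * c.toReal * growth 5 ^ 3 / (δ₀ / 3 * κ) ^ 3 *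
      p ^ 2 * h⁻¹ * g ^ (6 * p) := by
    have h5 : 0 ≤ growth 5 := zero_le_one.trans (one_le_growth (by norm_num))
    rw [hQ, mul_pow, mul_pow, mul_pow, traceConst, Real.sq_sqrt (by positivity), ← Real.rpow_natCast
      (h ^ _) 2, ← Real.rpow_mul hh.le, ← pow_mul]
    norm_num
    rw [Real.rpow_neg_one, show 3 * p * 2 = 6 * p by ring]
  have hcoef : M * c.toReal * (2 * g ^ (6 * p + 3)) ≤ b * Q ^ 2 := by
    have e : b * Q ^ 2 = 64 * Real.exp 3 * (19 * p) ^ 2 * h ^ 2 * c.toReal *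
        (2 * (g ^ (6 * p) * growth 5 ^ 3)) := by
      rw [hQ2, hb]; field_simp
    rw [e, hM, pow_add]
    have hp' : (1 : ℝ) ≤ p := by exact_mod_cast hp
    gcongr
    push_cast
    linarith
  have hfin : B ≤ ENNReal.ofReal (Q ^ 2) * I := by
    rw [← ENNReal.mul_le_mul_iff_right (a := ENNReal.ofReal b)
      (by rw [Ne, ENNReal.ofReal_eq_zero, not_le]; exact hb0) ENNReal.ofReal_ne_top, ← mul_assoc,
      ← ENNReal.ofReal_mul hb0.le]
    exact hBI.trans (by gcongr)
  rw [boundaryNormL2, normL2, eLpNorm_two_eq_lintegral, eLpNorm_two_eq_lintegral]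
  calc B ^ (1 / 2 : ℝ) ≤ (ENNReal.ofReal (Q ^ 2) * I) ^ (1 / 2 : ℝ) := by gcongr
    _ = ENNReal.ofReal Q * I ^ (1 / 2 : ℝ) := by
        rw [ENNReal.mul_rpow_of_nonneg _ _ (by norm_num),
          ENNReal.ofReal_rpow_of_nonneg (sq_nonneg _) (by norm_num), ← Real.sqrt_eq_rpow,
          Real.sqrt_sq hQ0]

/-- The inverse trace estimate on `K ∩ U`, if the deviation of the boundary of `U` in `K` from the
plane of a triangle is at most `1 / 2`, relative to the distance of a vertex `A` to this plane. -/
lemma boundaryNormL2_le_of_deviation {𝕜 : Type*} [RCLike 𝕜] {K : Hexahedron} {U S : Set E3}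
    (hU : IsOpen U) {A : E3} (hA : A ∈ K.vertices) (hAU : A ∈ U) (f : Affine.Triangle ℝ E3)
    {κ δ₀ η : ℝ} (hκ : 0 < κ) (hδ₀ : 0 < δ₀) (hδ₁ : δ₀ < 1 / 2) (hη0 : 0 ≤ η) (hη : η ≤ 1 / 2)
    (hK : ∀ k, κ * K.size ≤ K.hi k - K.lo k) (hfr : K.carrier ∩ frontier U ⊆ S)
    (hdev : distH S (planeOf f) / Metric.infEDist A (planeOf f) ≤ ENNReal.ofReal η)
    {x : E3} (hxK : x ∈ K.carrier) (hx : x ∈ frontier U) (hx' : x ∈ closure (closure U)ᶜ)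
    (hlarge : ∀ a b, K.IsEdge a b → (segment ℝ a b ∩ U).Nonempty →
      ENNReal.ofReal δ₀ ≤ volume {t : ℝ | t ∈ Icc (0 : ℝ) 1 ∧ AffineMap.lineMap a b t ∈ U})
    {c : ℝ≥0∞} (hc : c ≠ ∞)
    (hreg : ∀ (z : E3) (r : ℝ), 0 < r → (Measure.euclideanHausdorffMeasure 2 : Measure E3)
        (frontier (K.carrier ∩ U) ∩ Metric.closedBall z r) ≤ c * ENNReal.ofReal (r ^ 2))
    {p : ℕ} (hp : 1 ≤ p) {v : MvPolynomial (Fin 3) 𝕜} (hv : IsQ p v) :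
    boundaryNormL2 (K.carrier ∩ U) (polyFun v) ≤
      ENNReal.ofReal (traceConst κ δ₀ c.toReal * p * K.size ^ (-(1 / 2) : ℝ) *
        growth ((1 + 3 * η) / (1 - η)) ^ (3 * p)) * normL2 (K.carrier ∩ U) (polyFun v) := by
  obtain ⟨L, r, hL, hdist⟩ := exists_infEDist_planeOf f
  set d := distH S (planeOf f) with hd
  have hle : ∀ y ∈ S, ENNReal.ofReal |L y - r| ≤ d := fun y hy => by
    rw [← hdist]; exact le_iSup₂ (f := fun y _ => Metric.infEDist y (planeOf f)) y hy
  rw [hdist] at hdev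
  -- the vertex is not on the plane
  have hne : L A ≠ r := by
    intro h
    have hd0 : d = 0 := by
      by_contra hd0
      rw [h, sub_self, abs_zero, ENNReal.ofReal_zero, ENNReal.div_zero hd0] at hdev
      exact absurd hdev (not_le.2 ENNReal.ofReal_lt_top)
    refine ne_of_frontier_subset_plane hU (K.vertices_subset_closed hA) hAU hxK hx hx' hL
      (fun y hy hyf => ?_) h
    have := hle y (hfr ⟨hy, hyf⟩)
    rw [hd0, nonpos_iff_eq_zero, ENNReal.ofReal_eq_zero] at this
    exact sub_eq_zero.1 (abs_eq_zero.1 (le_antisymm this (abs_nonneg _)))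
  have hpos : 0 < |L A - r| := abs_pos.2 (sub_ne_zero.2 hne)
  have hdη : d ≤ ENNReal.ofReal (η * |L A - r|) := by
    rw [ENNReal.ofReal_mul hη0]
    exact (ENNReal.div_le_iff_le_mul (Or.inl (by
      rw [Ne, ENNReal.ofReal_eq_zero, not_le]; exact hpos)) (Or.inl ENNReal.ofReal_ne_top)).1 hdev
  have hfr' : ∀ y ∈ K.carrier, y ∈ frontier U → |L y - r| ≤ η * |L A - r| := fun y hy hyf =>
    (ENNReal.ofReal_le_ofReal_iff (by positivity)).1 ((hle y (hfr ⟨hy, hyf⟩)).trans hdη)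
  -- choose the sign of the affine function that is positive at `A`
  obtain ⟨E, hEo, hEc, hEK, hUE, hvol, hE⟩ : ∃ E : Set E3, IsOpen E ∧ Convex ℝ E ∧
      E ⊆ K.carrier ∧ K.carrier ∩ U ⊆ E ∧
      ENNReal.ofReal ((δ₀ / 3) ^ 3) * volume K.carrier ≤ volume E ∧
      ∀ (n : ℕ) (W : E3 → ℝ), Continuous W → (∀ x, 0 ≤ W x) → IsPolyOnLines n W →
        ∫⁻ x in E, ENNReal.ofReal (W x) ≤
          ENNReal.ofReal (2 * growth ((1 + 3 * η) / (1 - η)) ^ (n + 3)) *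
            ∫⁻ x in K.carrier ∩ U, ENNReal.ofReal (W x) := by
    rcases lt_or_gt_of_ne (sub_ne_zero.2 hne) with h | h
    · have h' : |L A - r| = (-L) A - -r := by
        rw [abs_of_neg h, neg_apply]; ring
      refine exists_convex_superset hU hA hAU (-L) (-r) (d := η * |L A - r|) (by positivity) hη0 hη
        (h' ▸ hpos) (by rw [h']) (fun y hy hyf => ?_) hδ₀ hδ₁ hlarge
      rw [neg_apply, ← abs_neg]
      convert hfr' y hy hyf using 2
      ring
    · have h' : |L A - r| = L A - r := abs_of_pos h
      exact exists_convex_superset hU hA hAU L r (d := η * |L A - r|) (by positivity) hη0 hη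
        h (by rw [h']) hfr' hδ₀ hδ₁ hlarge
  exact boundaryNormL2_le hκ hδ₀ hη0 hη hK hEo hEc hEK hUE hvol hE hc hreg hp hv

/-! ### Macro-elements -/

lemma Hexahedron.bounds_of_closed_subset {K K' : Hexahedron} (h : K'.closed ⊆ K.closed) (k : Fin 3) :
    K.lo k ≤ K'.lo k ∧ K'.hi k ≤ K.hi k :=
  ⟨(h (show K'.lo ∈ K'.closed from fun l => ⟨le_rfl, (K'.lo_lt_hi l).le⟩) k).1,
    (h (show K'.hi ∈ K'.closed from fun l => ⟨(K'.lo_lt_hi l).le, le_rfl⟩) k).2⟩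

lemma Hexahedron.carrier_subset_of_closed_subset {K K' : Hexahedron} (h : K'.closed ⊆ K.closed) :
    K'.carrier ⊆ K.carrier := fun _ hx k =>
  ⟨(Hexahedron.bounds_of_closed_subset h k).1.trans_lt (hx k).1,
    (hx k).2.trans_le (Hexahedron.bounds_of_closed_subset h k).2⟩

section

variable {Ω Ω₁ : Set E3} {κ δ₀ C₀ : ℝ} {T : Set Hexahedron} {N : Hexahedron → Hexahedron}

lemma closed_subset_macroElement (hN : IsMacroElementMap Ω Ω₁ δ₀ C₀ T N) {K : Hexahedron}
    (hK : K ∈ interfaceElements Ω₁ T ∪ boundaryElements Ω T) : K.closed ⊆ (N K).closed := by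
  obtain ⟨S, -, hKS, h⟩ := hN.union K hK
  rw [h]
  exact subset_biUnion_of_mem (u := fun K' : Hexahedron => K'.closed) hKS

lemma notMem_subdomain_of_mem_interface (hΩ : IsInterfaceGeometry Ω Ω₁) {x : E3}
    (hx : x ∈ frontier Ω₁) (i : Fin 2) : x ∉ subdomain Ω Ω₁ i := by
  rw [hΩ.isOpen_one.frontier_eq] at hx
  fin_cases i
  · exact hx.2
  · exact fun h => h.2 hx.1

lemma notMem_subdomain_of_mem_boundary (hΩ : IsInterfaceGeometry Ω Ω₁) {x : E3}
    (hx : x ∈ frontier Ω) (i : Fin 2) : x ∉ subdomain Ω Ω₁ i := by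
  rw [hΩ.isOpen.frontier_eq] at hx
  fin_cases i
  · exact fun h => hx.2 (hΩ.closure_subset (subset_closure h))
  · exact fun h => hx.2 h.1

/-- Macro-elements are shape regular. -/
lemma side_macroElement (hκ : 0 < κ) (hT : IsMesh Ω κ T)
    (hN : IsMacroElementMap Ω Ω₁ δ₀ C₀ T N) {K : Hexahedron}
    (hK : K ∈ interfaceElements Ω₁ T ∪ boundaryElements Ω T) (k : Fin 3) :
    κ / max C₀ 1 * (N K).size ≤ (N K).hi k - (N K).lo k := by
  have hKT : K ∈ T := hK.elim (fun h => h.1) fun h => h.1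
  have h1 := Hexahedron.bounds_of_closed_subset (closed_subset_macroElement hN hK) k
  have h2 := hT.shape_regular K hKT k
  have h3 : (N K).size ≤ max C₀ 1 * K.size :=
    (hN.size_le K hK).trans (mul_le_mul_of_nonneg_right (le_max_left _ _) K.size_pos.le)
  have hM : 0 < max C₀ 1 := lt_max_of_lt_right one_pos
  calc κ / max C₀ 1 * (N K).size ≤ κ / max C₀ 1 * (max C₀ 1 * K.size) := by gcongr
    _ = κ * K.size := by field_simp
    _ ≤ K.hi k - K.lo k := h2
    _ ≤ _ := by linarith [h1.1, h1.2]

/-- An element of the induced mesh that meets the interface or the boundary is a macro-element. -/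
lemma exists_eq_macroElement (hΩ : IsInterfaceGeometry Ω Ω₁) {K : Hexahedron}
    (hK : K ∈ inducedMesh Ω Ω₁ T N) (hm : K.MeetsInterface Ω₁ ∨ K.MeetsBoundary Ω) :
    ∃ K' ∈ interfaceElements Ω₁ T ∪ boundaryElements Ω T, N K' = K := by
  rcases hK with ⟨K', hK', h⟩ | ⟨-, ⟨i, hi⟩, -⟩
  · exact ⟨K', hK', h⟩
  · exfalso
    rcases hm with ⟨x, hxK, hx⟩ | ⟨x, hxK, hx⟩
    · exact notMem_subdomain_of_mem_interface hΩ hx i (hi hxK)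
    · exact notMem_subdomain_of_mem_boundary hΩ hx i (hi hxK)

lemma LargeWrt.edges {i : Fin 2} {K : Hexahedron} (h : K.LargeWrt Ω Ω₁ δ₀ i) {x : E3}
    (hxK : x ∈ K.carrier) (hx : x ∉ subdomain Ω Ω₁ i) (a b : E3) (hab : K.IsEdge a b)
    (hne : (segment ℝ a b ∩ subdomain Ω Ω₁ i).Nonempty) :
    ENNReal.ofReal δ₀ ≤
      volume {t : ℝ | t ∈ Icc (0 : ℝ) 1 ∧ AffineMap.lineMap a b t ∈ subdomain Ω Ω₁ i} := by
  rcases h with h | h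
  · exact absurd (h hxK) hx
  · exact h.2 a b hab hne

/-- Points of the interface are limits of interior and exterior points of both subdomains. -/
lemma mem_frontier_subdomain (hΩ : IsInterfaceGeometry Ω Ω₁) {x : E3} (hx : x ∈ frontier Ω₁)
    (i : Fin 2) : x ∈ frontier (subdomain Ω Ω₁ i) ∧ x ∈ closure (closure (subdomain Ω Ω₁ i))ᶜ := by
  have hxe := hΩ.smooth_interface.mem_closure_compl hx
  have hxΩ : x ∈ Ω := hΩ.closure_subset (frontier_subset_closure hx)
  fin_cases i
  · exact ⟨hx, hxe⟩
  · refine ⟨?_, ?_⟩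
    · rw [(isOpen_subdomain hΩ _).frontier_eq]
      refine ⟨?_, notMem_subdomain_of_mem_interface hΩ hx 1⟩
      have := hΩ.isOpen.inter_closure (t := (closure Ω₁)ᶜ) ⟨hxΩ, hxe⟩
      rwa [← sdiff_eq] at this
    · have hd : Disjoint Ω₁ (Ω \ closure Ω₁) :=
        disjoint_left.2 fun y hy hy' => hy'.2 (subset_closure hy)
      exact closure_mono (disjoint_left.1 (hd.closure_right hΩ.isOpen_one))
        (frontier_subset_closure hx)

/-- An element that meets the boundary but not the interface does not meet `Ω₁`. -/
lemma disjoint_carrier_of_meetsBoundary (hΩ : IsInterfaceGeometry Ω Ω₁) {K : Hexahedron}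
    (hb : K.MeetsBoundary Ω) (hi : ¬ K.MeetsInterface Ω₁) : Disjoint K.carrier (closure Ω₁) := by
  have hno : ∀ x ∈ K.carrier, x ∉ frontier Ω₁ := fun x hx hx' => hi ⟨x, hx, hx'⟩
  rcases Convex.subset_or_disjoint_of_frontier K.convex_carrier hΩ.isOpen_one hno with h | h
  · obtain ⟨x, hxK, hx⟩ := hb
    exact absurd (h hxK) (notMem_subdomain_of_mem_boundary hΩ hx 0)
  · exact h.closure_right K.isOpen_carrier

/-- On the edges of a boundary element, the condition of being large passes from `Ω₂` to `Ω`. An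
edge that meets `Ω` but not `Ω₂` is contained in the closure of `Ω₁`. -/
lemma edges_large_domain (hΩ : IsInterfaceGeometry Ω Ω₁) (hδ₁ : δ₀ < 1 / 2) {a b : E3}
    (h : (segment ℝ a b ∩ subdomain Ω Ω₁ 1).Nonempty → ENNReal.ofReal δ₀ ≤
      volume {t : ℝ | t ∈ Icc (0 : ℝ) 1 ∧ AffineMap.lineMap a b t ∈ subdomain Ω Ω₁ 1})
    (hne : (segment ℝ a b ∩ Ω).Nonempty) :
    ENNReal.ofReal δ₀ ≤ volume {t : ℝ | t ∈ Icc (0 : ℝ) 1 ∧ AffineMap.lineMap a b t ∈ Ω} := by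
  by_cases h2 : (segment ℝ a b ∩ subdomain Ω Ω₁ 1).Nonempty
  · exact (h h2).trans (measure_mono fun t ht => ⟨ht.1, ht.2.1⟩)
  · have hsub : segment ℝ a b ⊆ Ω := by
      intro y hy
      by_contra hyΩ
      obtain ⟨z, hz, hz1, hz2⟩ := (convex_segment a b).isPreconnected Ω (closure Ω₁)ᶜ hΩ.isOpen
        isClosed_closure.isOpen_compl (fun w _ => by
          by_cases hw : w ∈ closure Ω₁
          · exact Or.inl (hΩ.closure_subset hw)
          · exact Or.inr hw) hne ⟨y, hy, fun h' => hyΩ (hΩ.closure_subset h')⟩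
      exact h2 ⟨z, hz, hz1, hz2⟩
    have e : {t : ℝ | t ∈ Icc (0 : ℝ) 1 ∧ AffineMap.lineMap a b t ∈ Ω} = Icc 0 1 := by
      ext t
      refine ⟨fun ht => ht.1, fun ht => ⟨ht, hsub ?_⟩⟩
      rw [segment_eq_image_lineMap]
      exact mem_image_of_mem _ ht
    rw [e, Real.volume_Icc]
    exact ENNReal.ofReal_le_ofReal (by linarith)

end

end UnfittedFEM

end

theorem lemma3p4 (𝕜 : Type*) [RCLike 𝕜] (Ω Ω₁ : Set UnfittedFEM.E3)
    (hΩ : UnfittedFEM.IsInterfaceGeometry Ω Ω₁)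
    (κ δ₀ C₀ : ℝ) (hκ : 0 < κ) (hδ₀ : 0 < δ₀) (hδ₀' : δ₀ < 1 / 2) :
    ∃ C : ℝ, 0 < C ∧
      ∀ (T : Set UnfittedFEM.Hexahedron) (N : UnfittedFEM.Hexahedron → UnfittedFEM.Hexahedron),
        UnfittedFEM.IsMesh Ω κ T →
        UnfittedFEM.IsProperMesh Ω Ω₁ T →
        UnfittedFEM.IsMacroElementMap Ω Ω₁ δ₀ C₀ T N →
        -- no element of the induced mesh meets both the interface and the boundary
        (∀ K ∈ UnfittedFEM.inducedMesh Ω Ω₁ T N, ¬ (K.MeetsInterface Ω₁ ∧ K.MeetsBoundary Ω)) →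
        (∀ K ∈ UnfittedFEM.interfaceElements Ω₁ (UnfittedFEM.inducedMesh Ω Ω₁ T N),
          ∀ D : UnfittedFEM.InterfaceSplitting Ω Ω₁ K, D.deviation ≤ 1 / 2 →
            UnfittedFEM.InverseTraceEstimate 𝕜 Ω Ω₁ C K D.deviation.toReal) ∧
        (∀ K ∈ UnfittedFEM.boundaryElements Ω (UnfittedFEM.inducedMesh Ω Ω₁ T N),
          ∀ D : UnfittedFEM.BoundarySplitting Ω K, D.deviation ≤ 1 / 2 →
            UnfittedFEM.InverseTraceEstimate 𝕜 Ω Ω₁ C K D.deviation.toReal) := by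
  obtain ⟨c, hc, hreg⟩ := UnfittedFEM.exists_upperRegular_bound hΩ
  set κ' := κ / max C₀ 1 with hκ'
  have hκ'0 : 0 < κ' := div_pos hκ (lt_max_of_lt_right one_pos)
  -- the area bound is enlarged by `1`, so that the constant is positive
  have hc' : c + 1 ≠ ∞ := by finiteness
  have hreg' : ∀ (K : UnfittedFEM.Hexahedron) (i : Fin 2) (z : UnfittedFEM.E3) (r : ℝ), 0 < r →
      (Measure.euclideanHausdorffMeasure 2 : Measure UnfittedFEM.E3)
        (frontier (K.carrier ∩ UnfittedFEM.subdomain Ω Ω₁ i) ∩ Metric.closedBall z r) ≤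
        (c + 1) * ENNReal.ofReal (r ^ 2) := fun K i z r hr =>
    (hreg K i z r hr).trans (by gcongr; exact le_self_add)
  have hhalf : ∀ {η : ℝ≥0∞}, η ≤ 1 / 2 → η.toReal ≤ 1 / 2 ∧ ENNReal.ofReal η.toReal = η := by
    intro η hη
    have htop : (1 / 2 : ℝ≥0∞) ≠ ∞ := by finiteness
    refine ⟨?_, ENNReal.ofReal_toReal (ne_top_of_le_ne_top htop hη)⟩
    simpa using ENNReal.toReal_mono htop hη
  refine ⟨UnfittedFEM.traceConst κ' δ₀ (c + 1).toReal, ?_, ?_⟩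
  · have h1 : 0 < (c + 1).toReal := ENNReal.toReal_pos (by simp) hc'
    have h5 : 0 < UnfittedFEM.growth 5 :=
      one_pos.trans_le (UnfittedFEM.one_le_growth (by norm_num))
    unfold UnfittedFEM.traceConst
    positivity
  intro T N hT _ hN hboth
  refine ⟨?_, ?_⟩
  · rintro K ⟨hKM, hm⟩ D hD i p hp v hv
    obtain ⟨hη, hηe⟩ := hhalf hD
    obtain ⟨K', hK', rfl⟩ := UnfittedFEM.exists_eq_macroElement hΩ hKM (Or.inl hm)
    have hnb : ¬ (N K').MeetsBoundary Ω := fun h => hboth _ hKM ⟨hm, h⟩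
    have hK'i : K' ∈ UnfittedFEM.interfaceElements Ω₁ T := by
      rcases hK' with h | h
      · exact h
      · obtain ⟨x, hxK, hx⟩ := h.2
        exact absurd ⟨x, UnfittedFEM.Hexahedron.carrier_subset_of_closed_subset
          (UnfittedFEM.closed_subset_macroElement hN (Or.inr h)) hxK, hx⟩ hnb
    obtain ⟨x, hxK, hx⟩ := hm
    obtain ⟨hxf, hxe⟩ := UnfittedFEM.mem_frontier_subdomain hΩ hx i
    refine UnfittedFEM.boundaryNormL2_le_of_deviation (UnfittedFEM.isOpen_subdomain hΩ i)
      (D.apex_mem i).1 (D.apex_mem i).2 (D.face D.best) hκ'0 hδ₀ hδ₀' ENNReal.toReal_nonneg hη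
      (UnfittedFEM.side_macroElement hκ hT hN hK') (S := (N K').carrier ∩ frontier Ω₁) ?_ ?_
      hxK hxf hxe (UnfittedFEM.LargeWrt.edges (hN.large_interface K' hK'i i) hxK
        (UnfittedFEM.notMem_subdomain_of_mem_interface hΩ hx i)) hc' (hreg' _ i) hp hv
    · rintro y ⟨hyK, hy⟩
      rcases UnfittedFEM.frontier_subdomain_subset Ω Ω₁ i hy with h | h
      · exact ⟨hyK, h⟩
      · exact absurd ⟨y, hyK, h⟩ hnb
    · rw [hηe]
      exact le_iSup (fun i => UnfittedFEM.distH ((N K').carrier ∩ frontier Ω₁)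
        (UnfittedFEM.planeOf (D.face D.best)) /
          Metric.infEDist (D.apex i) (UnfittedFEM.planeOf (D.face D.best))) i
  · rintro K ⟨hKM, hm⟩ D hD i p hp v hv
    obtain ⟨hη, hηe⟩ := hhalf hD
    obtain ⟨K', hK', rfl⟩ := UnfittedFEM.exists_eq_macroElement hΩ hKM (Or.inr hm)
    have hni : ¬ (N K').MeetsInterface Ω₁ := fun h => hboth _ hKM ⟨h, hm⟩
    have hK'b : K' ∈ UnfittedFEM.boundaryElements Ω T := by
      rcases hK' with h | h
      · obtain ⟨x, hxK, hx⟩ := h.2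
        exact absurd ⟨x, UnfittedFEM.Hexahedron.carrier_subset_of_closed_subset
          (UnfittedFEM.closed_subset_macroElement hN (Or.inl h)) hxK, hx⟩ hni
      · exact h
    have hdisj := UnfittedFEM.disjoint_carrier_of_meetsBoundary hΩ hm hni
    obtain ⟨x, hxK, hx⟩ := hm
    fin_cases i
    · have hempty : (N K').carrier ∩ UnfittedFEM.subdomain Ω Ω₁ 0 = ∅ :=
        disjoint_iff_inter_eq_empty.1 (hdisj.mono_right subset_closure)
      simp [UnfittedFEM.boundaryNormL2, hempty]
    · -- the vertex of a boundary splitting may lie on the interface, so `Ω₂` is replaced by `Ω`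
      have hset : (N K').carrier ∩ UnfittedFEM.subdomain Ω Ω₁ 1 = (N K').carrier ∩ Ω := by
        ext y
        exact ⟨fun h => ⟨h.1, h.2.1⟩, fun h => ⟨h.1, h.2, disjoint_left.1 hdisj h.1⟩⟩
      have hregΩ := hreg' (N K') 1
      simp only [Fin.mk_one]
      rw [hset] at hregΩ ⊢
      exact UnfittedFEM.boundaryNormL2_le_of_deviation hΩ.isOpen
        D.apex_mem.1 D.apex_mem.2 (D.face D.best) hκ'0 hδ₀ hδ₀' ENNReal.toReal_nonneg hη
        (UnfittedFEM.side_macroElement hκ hT hN hK') (S := (N K').carrier ∩ frontier Ω) subset_rfl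
        (by rw [hηe]; exact le_rfl) hxK hx (hΩ.lipschitz_boundary.mem_closure_compl hx)
        (fun a b hab => UnfittedFEM.edges_large_domain hΩ hδ₀'
          (UnfittedFEM.LargeWrt.edges (hN.large_boundary K' hK'b) hxK
            (UnfittedFEM.notMem_subdomain_of_mem_boundary hΩ hx 1) a b hab)) hc' hregΩ hp hv
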